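/- **Conventions.** A *partial group* $\mathcal P$ is a set $\mathcal P_1$ with sets $\mathcal P_n\subseteq\mathcal P_1^n$ of words ($n\ge 1$) and products $\triangledown_n:\mathcal P_n\to\mathcal P_1$ ($\triangledown_1=\mathrm{id}$), a unit $1$ and inverses, such that deleting the first or last letter of a word of length $>1$ gives a word; replacing a block of consecutive letters of a word by its product gives a word with the same product; inserting $1$ anywhere in a word gives a word, and $\triangledown_2(1,\pi)=\triangledown_2(\pi,1)=\pi$; for $w=(\pi_1,\dots,\pi_n)\in\mathcal P_n$ and $w^{-1}=(\pi_n^{-1},\dots,\pi_1^{-1})$ both $w w^{-1}$ and $w^{-1}w$ are words; and $\triangledown_2(\pi,\pi^{-1})=\triangledown_2(\pi^{-1},\pi)=1$. Maps of partial groups are maps $\mathcal P_1\to\mathcal Q_1$ that send words to words and respect products. A group $G$ is a partial group with $G_n=G^n$. Let $E(d)$ be the group of isometries of $\mathbb R^d$, acting from the right, and $M(d)\le E(d)$ the subgroup of orientation-preserving ones. For $F\subseteq\mathbb R^d$ put $G(F)=\{a\in E(d): Fa=F\}$ and $SG(F)=G(F)\cap M(d)$. Let $cc(F)$ be the set of connected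 components of $F\neq\emptyset$. $\mathcal P(F)$ (resp. $S\mathcal P(F)$) is the partial group whose words of length $n$ are the sequences $(\pi_1,\dots,\pi_n)$ in $E(d)$ (resp. in $M(d)$) for which there is $K\in cc(F)$ with $K\pi_1,\,K\pi_1\pi_2,\dots,K\pi_1\cdots\pi_n\in cc(F)$, with $\triangledown_n(\pi_1,\dots,\pi_n)=\pi_1\cdots\pi_n$. $\mathcal V(\{0,1\})$ is the partial group with words $(\iota_1-\iota_0,\dots,\iota_n-\iota_{n-1})$, $\iota_0,\dots,\iota_n\in\{0,1\}$, and $\triangledown_n$ the sum $\iota_n-\iota_0$. $G_+\vee_{G_+\cap G_-}G_-$ is the pushout, in the category of partial groups, of the inclusions $G_+\leftarrow G_+\cap G_-\to G_-$. For partial groups $\mathcal F,\mathcal H$, an $\mathcal F$-partial group structure on $\mathcal H$ consists of subsets $\mathcal H_r\mathcal F_n\subseteq\mathcal H_r\times\mathcal F_n$ and maps $\lhd:\mathcal H_r\mathcal F_n\to\mathcal H_r$ ($r,n\ge1$; for $n=0$ one puts $\mathcal H_r\mathcal F_0=\mathcal H_r$, $\lhd=\mathrm{id}$) such that (i) for every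 $r$ they are a right action of $\mathcal F$ on the set $\mathcal H_r$, i.e. for $(x|w)\in\mathcal H_r\mathcal F_n$: the last letter of $w$ may be deleted; if $w=uv$ then $(\lhd(x|u)\,|\,v)$ is admissible and $\lhd(\lhd(x|u)|v)=\lhd(x|w)$; a block of $w$ may be replaced by its product without changing $\lhd(x|w)$; $1$ may be inserted anywhere in $w$, and $\lhd(x|1)=x$; $(x|ww^{-1})$ is admissible; and (ii) deleting the first or last letter, multiplying a block, inserting $1$, and $\eta\mapsto\eta\eta^{-1}$, $\eta\mapsto\eta^{-1}\eta$ (on words $\eta$ of $\mathcal H$) are compatible with these actions, and $(1|w)$ is admissible with $\lhd(1|w)=1$ for every word $w$ of $\mathcal F$. The *semidirect product* $\mathcal F\ltimes\mathcal H$ then has as elements the pairs $\gamma\ltimes\eta\in\mathcal F_1\times\mathcal H_1$ with $(\eta|\gamma^{-1})\in\mathcal H_1\mathcal F_1$, as words of length $n$ the $\alpha=(\gamma_i\ltimes\eta_i)_i$ with $(\eta_j|\gamma_{j+1},\dots,\gamma_n)\in\mathcal H_1\mathcal F_{n-j}$ for $1\le j<n$ and $(A(\alpha)\,|\,\gamma_n^{-1},\dots,\gamma_1^{-1})\in\mathcal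 H_n\mathcal F_n$, where $A(\alpha)=(\lhd(\eta_1|\gamma_2,\dots,\gamma_n),\dots,\lhd(\eta_{n-1}|\gamma_n),\eta_n)$, and products $\triangledown(\alpha)=\triangledown(\gamma_1,\dots,\gamma_n)\ltimes\triangledown(A(\alpha))$. **Theorem.** Let $F\subseteq\mathbb R^d$ be a figure consisting of exactly two connected components $F_+\ne F_-$ that are congruent ($F_+a=F_-$ for some $a\in E(d)$). Suppose that there is no isometry $a\in E(d)$ satisfying $F_+a=F_-$ and $F_-a=F_+$ simultaneously. Then $$\mathcal P(F)\;\cong\;\mathcal V(\{0,1\})\ltimes\bigl(G(F_+)\vee_{G(F_+)\cap G(F_-)}G(F_-)\bigr).$$ If moreover $F_+a=F_-$ for some $a\in M(d)$, then also $$S\mathcal P(F)\;\cong\;\mathcal V(\{0,1\})\ltimes\bigl(SG(F_+)\vee_{SG(F_+)\cap SG(F_-)}SG(F_-)\bigr).$$ Here the pushouts exist, and for any $\gamma\in E(d)$ (resp. $\gamma\in M(d)$) with $F_-\gamma=F_+$ one may take the following $\mathcal V(\{0,1\})$-partial group structure on the pushout $\mathcal H$, which is well defined. Write $G_1,G_0$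 for $G(F_+),G(F_-)$ (resp. $SG(F_+),SG(F_-)$). Then $$\mathcal H_r\mathcal V(\{0,1\})_n=\{(a\,|\,\iota_1-\iota_0,\dots,\iota_n-\iota_{n-1}) : \iota_0,\dots,\iota_n\in\{0,1\},\ a\in G_{\iota_0}^{\,r}\},$$ $$\lhd(a\,|\,\iota_1-\iota_0,\dots,\iota_n-\iota_{n-1})=(\gamma^{\iota_0-\iota_n}a_k\gamma^{\iota_n-\iota_0})_{1\le k\le r},$$ where words in $G_{\iota}$ are identified with their images in $\mathcal H$. -/

import Mathlib

open CategoryTheory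
open scoped Pointwise RightActions

universe u v

/-- A partial group `𝒫`.  The type `carrier` is `𝒫₁`; the words of length `n` in `dom` form `𝒫ₙ`
(`n ≥ 1`), and `nabla` restricted to them is `∇ₙ`.  The values of `nabla` outside `dom` carry no
meaning and are never used. -/
structure PartialGroup where
  carrier : Type u
  dom : Set (List carrier)
  nabla : List carrier → carrier
  one : carrier
  inv : carrier → carrier
  ne_nil : ∀ {w}, w ∈ dom → w ≠ []
  singleton_mem : ∀ x, [x] ∈ dom
  nabla_singleton : ∀ x, nabla [x] = x
  tail_mem : ∀ {x w}, x :: w ∈ dom → w ≠ [] → w ∈ dom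
  init_mem : ∀ {w x}, w ++ [x] ∈ dom → w ≠ [] → w ∈ dom
  contract_mem : ∀ {p q r}, p ++ q ++ r ∈ dom → q ≠ [] → p ++ [nabla q] ++ r ∈ dom
  nabla_contract : ∀ {p q r}, p ++ q ++ r ∈ dom → q ≠ [] →
    nabla (p ++ [nabla q] ++ r) = nabla (p ++ q ++ r)
  insert_one_mem : ∀ {p q}, p ++ q ∈ dom → p ++ [one] ++ q ∈ dom
  nabla_one_left : ∀ x, nabla [one, x] = x
  nabla_one_right : ∀ x, nabla [x, one] = x
  mul_inv_mem : ∀ {w}, w ∈ dom → w ++ (w.map inv).reverse ∈ dom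
  inv_mul_mem : ∀ {w}, w ∈ dom → (w.map inv).reverse ++ w ∈ dom
  nabla_mul_inv : ∀ x, nabla [x, inv x] = one
  nabla_inv_mul : ∀ x, nabla [inv x, x] = one

namespace PartialGroup

instance : CoeSort PartialGroup.{u} (Type u) := ⟨carrier⟩

/-- The inverse word `(πₙ⁻¹, …, π₁⁻¹)` of `(π₁, …, πₙ)`. -/
def invWord (P : PartialGroup.{u}) (w : List P) : List P := (w.map P.inv).reverse

/-- Maps of partial groups. -/
@[ext]
structure Hom (P Q : PartialGroup.{u}) where
  toFun : P → Q
  map_mem : ∀ {w}, w ∈ P.dom → w.map toFun ∈ Q.dom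
  map_nabla : ∀ {w}, w ∈ P.dom → Q.nabla (w.map toFun) = toFun (P.nabla w)

/-- The category of partial groups; its isomorphisms are the bijections `φ` such that both `φ` and
its inverse are maps of partial groups. -/
instance : Category PartialGroup.{u} where
  Hom := Hom
  id P := ⟨id, fun h => by simpa using h, fun _ => by simp⟩
  comp f g := ⟨g.toFun ∘ f.toFun,
    fun h => by simpa using g.map_mem (f.map_mem h),
    fun h => by
      have := g.map_nabla (f.map_mem h)
      rw [f.map_nabla h] at this
      simpa using this⟩

/-- The map `𝒫₁ → 𝒬₁` underlying a morphism. -/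
def Hom.fn {P Q : PartialGroup.{u}} (f : P ⟶ Q) : P → Q := Hom.toFun f

/-- A group, viewed as a partial group in which every nonempty word can be multiplied. -/
def ofGroup (G : Type u) [Group G] : PartialGroup.{u} where
  carrier := G
  dom := {w | w ≠ []}
  nabla := List.prod
  one := 1
  inv x := x⁻¹
  ne_nil h := h
  singleton_mem _ := by simp
  nabla_singleton _ := by simp
  tail_mem _ h := h
  init_mem _ h := h
  contract_mem _ _ := by simp
  nabla_contract _ _ := by simp
  insert_one_mem _ := by simp
  nabla_one_left _ := by simp
  nabla_one_right _ := by simp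
  mul_inv_mem h := by simp_all
  inv_mul_mem h := by simp_all
  nabla_mul_inv _ := by simp
  nabla_inv_mul _ := by simp

/-- A group homomorphism, viewed as a map of partial groups. -/
def ofGroupHom {G G' : Type u} [Group G] [Group G'] (f : G →* G') : ofGroup G ⟶ ofGroup G' :=
  Hom.mk (P := ofGroup G) (Q := ofGroup G') f
    (fun {w} (h : w ≠ []) => fun e => h (List.map_eq_nil_iff.mp e))
    (fun {w} _ => (MonoidHom.map_list_prod (M := G) (N := G') f w).symm)

/-! Elementary facts. -/

theorem right_mem (P : PartialGroup.{u}) {p q : List P} (h : p ++ q ∈ P.dom) (hq : q ≠ []) :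
    q ∈ P.dom := by
  induction p with
  | nil => simpa using h
  | cons x p ih => exact ih (P.tail_mem h (by simp [hq]))

theorem left_mem (P : PartialGroup.{u}) {p q : List P} (h : p ++ q ∈ P.dom) (hp : p ≠ []) :
    p ∈ P.dom := by
  induction q using List.reverseRecOn with
  | nil => simpa using h
  | append_singleton q x ih =>
    exact ih (P.init_mem (by simpa using h) (by simp [hp]))

theorem eq_inv (P : PartialGroup.{u}) {a b : P} (h : [a, b] ∈ P.dom)
    (hab : P.nabla [a, b] = P.one) : b = P.inv a := by
  have h1 : [P.inv b] ++ [P.inv a, a, b] ∈ P.dom := by simpa using P.inv_mul_mem h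
  have h2 : [P.inv a, a, b] ∈ P.dom := P.right_mem h1 (by simp)
  have e1 := P.nabla_contract (p := []) (q := [P.inv a, a]) (r := [b]) h2 (by simp)
  have e2 := P.nabla_contract (p := [P.inv a]) (q := [a, b]) (r := []) h2 (by simp)
  rw [P.nabla_inv_mul] at e1
  rw [hab] at e2
  simp only [List.nil_append, List.cons_append, List.append_nil, P.nabla_one_left,
    P.nabla_one_right] at e1 e2
  exact e1.trans e2.symm

theorem inv_inv (P : PartialGroup.{u}) (a : P) : P.inv (P.inv a) = a := by
  refine (P.eq_inv ?_ (P.nabla_inv_mul a)).symm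
  simpa using P.inv_mul_mem (P.singleton_mem a)

theorem inv_one (P : PartialGroup.{u}) : P.inv P.one = P.one := by
  refine (P.eq_inv ?_ (P.nabla_one_left P.one)).symm
  simpa using P.insert_one_mem (p := []) (P.singleton_mem P.one)

@[simp] theorem invWord_nil (P : PartialGroup.{u}) : P.invWord [] = [] := rfl

theorem invWord_append (P : PartialGroup.{u}) (u v : List P) :
    P.invWord (u ++ v) = P.invWord v ++ P.invWord u := by simp [invWord]

theorem invWord_singleton (P : PartialGroup.{u}) (a : P) : P.invWord [a] = [P.inv a] := rfl

theorem invWord_cons (P : PartialGroup.{u}) (a : P) (u : List P) :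
    P.invWord (a :: u) = P.invWord u ++ [P.inv a] := by simp [invWord]

theorem invWord_invWord (P : PartialGroup.{u}) (u : List P) : P.invWord (P.invWord u) = u := by
  induction u with
  | nil => rfl
  | cons a u ih => rw [invWord_cons, invWord_append, ih, invWord_singleton, inv_inv]; rfl

theorem invWord_ne_nil (P : PartialGroup.{u}) {u : List P} (h : u ≠ []) : P.invWord u ≠ [] := by
  simpa [invWord] using h

theorem erase_one (P : PartialGroup.{u}) {p r : List P} (h : p ++ [P.one] ++ r ∈ P.dom)
    (hpr : p ++ r ≠ []) :
    p ++ r ∈ P.dom ∧ P.nabla (p ++ r) = P.nabla (p ++ [P.one] ++ r) := by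
  rcases List.eq_nil_or_concat p with rfl | ⟨p', a, rfl⟩
  · cases r with
    | nil => simp at hpr
    | cons b r =>
      have h' : [] ++ [P.one, b] ++ r ∈ P.dom := by simpa using h
      have m := P.contract_mem h' (by simp)
      have e := P.nabla_contract h' (by simp)
      rw [P.nabla_one_left] at m e
      exact ⟨by simpa using m, by simpa using e⟩
  · have h' : p' ++ [a, P.one] ++ r ∈ P.dom := by simpa using h
    have m := P.contract_mem h' (by simp)
    have e := P.nabla_contract h' (by simp)
    rw [P.nabla_one_right] at m e
    exact ⟨by simpa using m, by simpa using e⟩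

theorem nabla_mul_invWord (P : PartialGroup.{u}) {w : List P} (h : w ∈ P.dom) :
    P.nabla (w ++ P.invWord w) = P.one := by
  induction w using List.reverseRecOn with
  | nil => exact absurd rfl (P.ne_nil h)
  | append_singleton w a ih =>
    by_cases hw : w = []
    · subst hw; exact P.nabla_mul_inv a
    · have h1 : w ++ [a, P.inv a] ++ P.invWord w ∈ P.dom := by
        have := P.mul_inv_mem h
        simpa [invWord] using this
      have m := P.contract_mem h1 (by simp)
      have e := P.nabla_contract h1 (by simp)
      rw [P.nabla_mul_inv] at m e
      have := P.erase_one m (by simp [hw])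
      rw [invWord_append, invWord_singleton]
      have e2 : w ++ [a] ++ ([P.inv a] ++ P.invWord w) = w ++ [a, P.inv a] ++ P.invWord w := by simp
      rw [e2, ← e, ← this.2]
      exact ih (P.left_mem h hw)

theorem invWord_mem (P : PartialGroup.{u}) {w : List P} (h : w ∈ P.dom) : P.invWord w ∈ P.dom :=
  P.right_mem (P.mul_inv_mem h) (P.invWord_ne_nil (P.ne_nil h))

theorem nabla_invWord (P : PartialGroup.{u}) {w : List P} (h : w ∈ P.dom) :
    P.nabla (P.invWord w) = P.inv (P.nabla w) := by
  have h0 := P.ne_nil h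
  have h1 : [] ++ w ++ P.invWord w ∈ P.dom := P.mul_inv_mem h
  have m1 := P.contract_mem h1 h0
  have e1 := P.nabla_contract h1 h0
  have h2 : [P.nabla w] ++ P.invWord w ++ [] ∈ P.dom := by simpa using m1
  have m2 := P.contract_mem h2 (P.invWord_ne_nil h0)
  have e2 := P.nabla_contract h2 (P.invWord_ne_nil h0)
  refine P.eq_inv (by simpa using m2) ?_
  simp only [List.nil_append, List.append_nil, List.cons_append] at e1 e2
  rw [e2, e1]
  exact P.nabla_mul_invWord h

end PartialGroup

/-- The axioms of a partial group, for a set `dom` of nonempty words over an ambient type `T`; the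
elements of the partial group are those `t : T` for which the one-letter word `[t]` lies in `dom`. -/
structure WordSystem (T : Type u) where
  dom : Set (List T)
  nabla : List T → T
  one : T
  inv : T → T
  ne_nil : ∀ {w}, w ∈ dom → w ≠ []
  nabla_singleton : ∀ x, nabla [x] = x
  tail_mem : ∀ {x w}, x :: w ∈ dom → w ≠ [] → w ∈ dom
  init_mem : ∀ {w x}, w ++ [x] ∈ dom → w ≠ [] → w ∈ dom
  contract_mem : ∀ {p q r}, p ++ q ++ r ∈ dom → q ≠ [] → p ++ [nabla q] ++ r ∈ dom
  nabla_contract : ∀ {p q r}, p ++ q ++ r ∈ dom → q ≠ [] →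
    nabla (p ++ [nabla q] ++ r) = nabla (p ++ q ++ r)
  one_mem : [one] ∈ dom
  insert_one_mem : ∀ {p q}, p ++ q ∈ dom → p ++ [one] ++ q ∈ dom
  nabla_one_left : ∀ {x}, [x] ∈ dom → nabla [one, x] = x
  nabla_one_right : ∀ {x}, [x] ∈ dom → nabla [x, one] = x
  mul_inv_mem : ∀ {w}, w ∈ dom → w ++ (w.map inv).reverse ∈ dom
  inv_mul_mem : ∀ {w}, w ∈ dom → (w.map inv).reverse ++ w ∈ dom
  nabla_mul_inv : ∀ {x}, [x] ∈ dom → nabla [x, inv x] = one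
  nabla_inv_mul : ∀ {x}, [x] ∈ dom → nabla [inv x, x] = one

namespace WordSystem

theorem nabla_mem {T : Type u} (D : WordSystem T) {w : List T} (h : w ∈ D.dom) :
    [D.nabla w] ∈ D.dom := by
  simpa [-List.map_subtype] using D.contract_mem (p := []) (q := w) (r := []) (by simpa [-List.map_subtype] using h) (D.ne_nil h)

theorem right_mem {T : Type u} (D : WordSystem T) {p q : List T} (h : p ++ q ∈ D.dom)
    (hq : q ≠ []) : q ∈ D.dom := by
  induction p with
  | nil => simpa [-List.map_subtype] using h
  | cons x p ih => exact ih (D.tail_mem h (by simp [hq]))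

theorem left_mem {T : Type u} (D : WordSystem T) {p q : List T} (h : p ++ q ∈ D.dom)
    (hp : p ≠ []) : p ∈ D.dom := by
  induction q using List.reverseRecOn with
  | nil => simpa [-List.map_subtype] using h
  | append_singleton q x ih =>
    exact ih (D.init_mem (by simpa [-List.map_subtype] using h) (by simp [hp]))

theorem inv_mem {T : Type u} (D : WordSystem T) {x : T} (h : [x] ∈ D.dom) :
    [D.inv x] ∈ D.dom := by
  have h1 : [x] ++ [D.inv x] ∈ D.dom := D.mul_inv_mem h
  exact D.right_mem h1 (by simp)

open Classical in
/-- The partial group described by a system of words. -/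
noncomputable def toPartialGroup {T : Type u} (D : WordSystem T) : PartialGroup.{u} where
  carrier := {t : T // [t] ∈ D.dom}
  dom := {w | w.map Subtype.val ∈ D.dom}
  nabla w := if h : w.map Subtype.val ∈ D.dom then ⟨D.nabla (w.map Subtype.val), D.nabla_mem h⟩
    else ⟨D.one, D.one_mem⟩
  one := ⟨D.one, D.one_mem⟩
  inv x := ⟨D.inv x.1, D.inv_mem x.2⟩
  ne_nil h := by simpa [-List.map_subtype] using D.ne_nil h
  singleton_mem x := x.2
  nabla_singleton x := by
    have : List.map Subtype.val [x] ∈ D.dom := x.2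
    rw [dif_pos this]
    exact Subtype.ext (D.nabla_singleton _)
  tail_mem h hw := D.tail_mem (by simpa [-List.map_subtype] using h) (by simpa [-List.map_subtype] using hw)
  init_mem h hw := D.init_mem (by simpa [-List.map_subtype] using h) (by simpa [-List.map_subtype] using hw)
  contract_mem {p q r} h hq := by
    have h1 : p.map Subtype.val ++ q.map Subtype.val ++ r.map Subtype.val ∈ D.dom := by
      simpa [-List.map_subtype] using h
    have hq1 : q.map Subtype.val ≠ [] := by simpa [-List.map_subtype] using hq
    have h2 : q.map Subtype.val ∈ D.dom := D.right_mem (D.left_mem h1 (by simp [-List.map_subtype, hq])) hq1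
    have := D.contract_mem h1 hq1
    rw [dif_pos h2]
    simpa [-List.map_subtype] using this
  nabla_contract {p q r} h hq := by
    have h1 : p.map Subtype.val ++ q.map Subtype.val ++ r.map Subtype.val ∈ D.dom := by
      simpa [-List.map_subtype] using h
    have hq1 : q.map Subtype.val ≠ [] := by simpa [-List.map_subtype] using hq
    have h2 : q.map Subtype.val ∈ D.dom := D.right_mem (D.left_mem h1 (by simp [-List.map_subtype, hq])) hq1
    have m := D.contract_mem h1 hq1
    have e := D.nabla_contract h1 hq1
    rw [dif_pos h2]
    have m' : (p ++ [(⟨D.nabla (q.map Subtype.val), D.nabla_mem h2⟩ : {t : T // [t] ∈ D.dom})]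
      ++ r).map Subtype.val ∈ D.dom := by simpa [-List.map_subtype] using m
    have h' : (p ++ q ++ r).map Subtype.val ∈ D.dom := h
    rw [dif_pos m', dif_pos h']
    exact Subtype.ext (by simpa [-List.map_subtype] using e)
  insert_one_mem h := by
    have := D.insert_one_mem (by simpa [-List.map_subtype] using h)
    simpa [-List.map_subtype] using this
  nabla_one_left x := by
    have : List.map Subtype.val [(⟨D.one, D.one_mem⟩ : {t : T // [t] ∈ D.dom}), x] ∈ D.dom :=
      D.insert_one_mem (p := []) x.2
    rw [dif_pos this]
    exact Subtype.ext (D.nabla_one_left x.2)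
  nabla_one_right x := by
    have : List.map Subtype.val [x, (⟨D.one, D.one_mem⟩ : {t : T // [t] ∈ D.dom})] ∈ D.dom :=
      D.insert_one_mem (p := [x.1]) (q := []) x.2
    rw [dif_pos this]
    exact Subtype.ext (D.nabla_one_right x.2)
  mul_inv_mem h := by
    have := D.mul_inv_mem h
    simpa [-List.map_subtype, Function.comp_def] using this
  inv_mul_mem h := by
    have := D.inv_mul_mem h
    simpa [-List.map_subtype, Function.comp_def] using this
  nabla_mul_inv x := by
    have : List.map Subtype.val [x, (⟨D.inv x.1, D.inv_mem x.2⟩ : {t : T // [t] ∈ D.dom})] ∈ D.dom :=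
      D.mul_inv_mem x.2
    rw [dif_pos this]
    exact Subtype.ext (D.nabla_mul_inv x.2)
  nabla_inv_mul x := by
    have : List.map Subtype.val [(⟨D.inv x.1, D.inv_mem x.2⟩ : {t : T // [t] ∈ D.dom}), x] ∈ D.dom :=
      D.inv_mul_mem x.2
    rw [dif_pos this]
    exact Subtype.ext (D.nabla_inv_mul x.2)

/-- The element of the ambient type underlying an element of `D.toPartialGroup`. -/
def val {T : Type u} {D : WordSystem T} (x : D.toPartialGroup) : T := Subtype.val x

end WordSystem

/-- `IsRoute act X x w y`: the word `w = (t₁, …, tₙ)` leads from `x` to `y`, and all the points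
`x, xt₁, xt₁t₂, …, y` of the route lie in `X`. -/
def IsRoute {X₀ : Type v} {T : Type u} (act : X₀ → T → X₀) (X : Set X₀) : X₀ → List T → X₀ → Prop
  | x, [], y => x ∈ X ∧ x = y
  | x, t :: w, y => x ∈ X ∧ IsRoute act X (act x t) w y

namespace IsRoute

variable {X₀ : Type v} {T : Type u} {act : X₀ → T → X₀} {X : Set X₀}

theorem append_iff {u w : List T} {x z : X₀} :
    IsRoute act X x (u ++ w) z ↔ ∃ y, IsRoute act X x u y ∧ IsRoute act X y w z := by
  induction u generalizing x with
  | nil =>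
    constructor
    · intro h
      exact ⟨x, ⟨by cases w <;> exact h.1, rfl⟩, h⟩
    · rintro ⟨y, ⟨_, rfl⟩, h⟩
      exact h
  | cons a u ih =>
    simp only [List.cons_append, IsRoute, ih]
    constructor
    · rintro ⟨h, y, h1, h2⟩
      exact ⟨y, ⟨h, h1⟩, h2⟩
    · rintro ⟨y, ⟨h, h1⟩, h2⟩
      exact ⟨h, y, h1, h2⟩

theorem left_mem {w : List T} {x y : X₀} (h : IsRoute act X x w y) : x ∈ X := by
  cases w <;> exact h.1

theorem right_mem {w : List T} {x y : X₀} (h : IsRoute act X x w y) : y ∈ X := by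
  induction w generalizing x with
  | nil => exact h.2 ▸ h.1
  | cons a w ih => exact ih h.2

theorem foldl_eq {w : List T} {x y : X₀} (h : IsRoute act X x w y) : w.foldl act x = y := by
  induction w generalizing x with
  | nil => exact h.2
  | cons a w ih => exact ih h.2

end IsRoute

/-- The system of all words that describe a route in `X`, for letters that multiply as in a group
acting from the right. -/
def routeSystem {X₀ : Type v} {T : Type u} (act : X₀ → T → X₀) (X : Set X₀) (hX : X.Nonempty)
    (prod : List T → T) (one : T) (inv : T → T)
    (prod_singleton : ∀ x, prod [x] = x)
    (prod_contract : ∀ p q r, prod (p ++ [prod q] ++ r) = prod (p ++ q ++ r))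
    (prod_one_left : ∀ x, prod [one, x] = x) (prod_one_right : ∀ x, prod [x, one] = x)
    (prod_mul_inv : ∀ x, prod [x, inv x] = one) (prod_inv_mul : ∀ x, prod [inv x, x] = one)
    (act_prod : ∀ x w, act x (prod w) = w.foldl act x) (act_one : ∀ x, act x one = x)
    (act_inv : ∀ x t, act (act x t) (inv t) = x) : WordSystem T where
  dom := {w | w ≠ [] ∧ ∃ x y, IsRoute act X x w y}
  nabla := prod
  one := one
  inv := inv
  ne_nil h := h.1
  nabla_singleton := prod_singleton
  tail_mem := by
    rintro a w ⟨-, x, y, h⟩ hw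
    exact ⟨hw, _, y, h.2⟩
  init_mem := by
    rintro w a ⟨-, x, y, h⟩ hw
    obtain ⟨z, h1, -⟩ := IsRoute.append_iff.1 h
    exact ⟨hw, x, z, h1⟩
  contract_mem := by
    rintro p q r ⟨-, x, y, h⟩ hq
    obtain ⟨z, h1, h3⟩ := IsRoute.append_iff.1 h
    obtain ⟨z', h1, h2⟩ := IsRoute.append_iff.1 h1
    refine ⟨by simp, x, y, IsRoute.append_iff.2 ⟨z, IsRoute.append_iff.2 ⟨z', h1, ?_⟩, h3⟩⟩
    have e : act z' (prod q) = z := by rw [act_prod, h2.foldl_eq]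
    exact ⟨h2.left_mem, by rw [e]; exact ⟨h2.right_mem, rfl⟩⟩
  nabla_contract _ _ := prod_contract _ _ _
  one_mem := by
    obtain ⟨x, hx⟩ := hX
    exact ⟨by simp, x, x, hx, by rw [act_one]; exact hx, act_one x⟩
  insert_one_mem := by
    rintro p q ⟨-, x, y, h⟩
    obtain ⟨z, h1, h2⟩ := IsRoute.append_iff.1 h
    refine ⟨by simp, x, y, IsRoute.append_iff.2 ⟨z, IsRoute.append_iff.2 ⟨z, h1, ?_⟩, h2⟩⟩
    exact ⟨h2.left_mem, by rw [act_one]; exact ⟨h2.left_mem, rfl⟩⟩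
  nabla_one_left _ := prod_one_left _
  nabla_one_right _ := prod_one_right _
  mul_inv_mem := by
    rintro w ⟨hw, x, y, h⟩
    refine ⟨by simp [hw], x, x, IsRoute.append_iff.2 ⟨y, h, ?_⟩⟩
    clear hw
    induction w generalizing x with
    | nil => exact ⟨h.right_mem, h.2.symm⟩
    | cons a w ih =>
      have := ih _ h.2
      rw [List.map_cons, List.reverse_cons]
      exact IsRoute.append_iff.2 ⟨_, this, h.2.left_mem, by
        rw [act_inv]; exact ⟨h.1, rfl⟩⟩
  inv_mul_mem := by
    rintro w ⟨hw, x, y, h⟩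
    refine ⟨by simp [hw], y, y, IsRoute.append_iff.2 ⟨x, ?_, h⟩⟩
    clear hw
    induction w generalizing x with
    | nil => exact ⟨h.right_mem, h.2.symm⟩
    | cons a w ih =>
      have := ih _ h.2
      rw [List.map_cons, List.reverse_cons]
      exact IsRoute.append_iff.2 ⟨_, this, h.2.left_mem, by
        rw [act_inv]; exact ⟨h.1, rfl⟩⟩
  nabla_mul_inv _ := prod_mul_inv _
  nabla_inv_mul _ := prod_inv_mul _

/-- The words of `𝒱(P)`: the sequences `(P₀P₁, P₁P₂, …, Pₙ₋₁Pₙ)` of displacement vectors along a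
sequence of points `P₀, …, Pₙ` of `P` (`n ≥ 1`), with `∇` the sum, that is the vector `P₀Pₙ`. -/
def vectorSystem {A : Type u} [AddCommGroup A] (P : Set A) (hP : P.Nonempty) : WordSystem A :=
  routeSystem (fun x v : A => x + v) P hP List.sum 0 (fun v => -v)
    (by simp) (by simp) (by simp) (by simp) (by simp) (by simp)
    (fun x w => by
      induction w generalizing x with
      | nil => simp
      | cons a w ih => rw [List.sum_cons, List.foldl_cons, ← ih, add_assoc])
    (by simp) (by simp)

/-- The partial group `𝒱(P)` of vector parades generated by `P`. -/
noncomputable def vectorParades {A : Type u} [AddCommGroup A] (P : Set A) (hP : P.Nonempty) :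
    PartialGroup.{u} :=
  (vectorSystem P hP).toPartialGroup

/-- The vector underlying an element of `𝒱(P)`. -/
noncomputable def vectorParades.vec {A : Type u} [AddCommGroup A] {P : Set A} {hP : P.Nonempty}
    (v : vectorParades P hP) : A :=
  WordSystem.val (D := vectorSystem P hP) v

/-- The partial group `𝒱({0, 1})`. -/
noncomputable def V01 : PartialGroup.{0} := vectorParades ({0, 1} : Set ℤ) ⟨0, by simp⟩

/-- The words of `𝒫(X) = 𝒫(X, X₀, G₀)` for a right `G₀`-set `X₀` and `X ⊆ X₀`: the parades in `X`,
that is the words `(π₁, …, πₙ)` in `G₀` for which there is an `x` such that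
`x, xπ₁, xπ₁π₂, …, xπ₁⋯πₙ` all lie in `X`; `∇` is the product in `G₀`. -/
def paradeSystem (G₀ : Type u) [Group G₀] {X₀ : Type v} [MulAction G₀ᵐᵒᵖ X₀] (X : Set X₀)
    (hX : X.Nonempty) : WordSystem G₀ :=
  routeSystem (fun (x : X₀) (g : G₀) => x <• g) X hX List.prod 1 (fun g => g⁻¹)
    (by simp) (by simp) (by simp) (by simp) (by simp) (by simp)
    (fun x w => by
      induction w generalizing x with
      | nil => simp
      | cons a w ih => rw [List.prod_cons, List.foldl_cons, ← ih, op_smul_op_smul])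
    (by simp) (by simp)

/-- The parade partial group `𝒫(X) = 𝒫(X, X₀, G₀)`. -/
noncomputable def parades (G₀ : Type u) [Group G₀] {X₀ : Type v} [MulAction G₀ᵐᵒᵖ X₀] (X : Set X₀)
    (hX : X.Nonempty) : PartialGroup.{u} :=
  (paradeSystem G₀ X hX).toPartialGroup

/-- The symmetry group `G(X) = G(X, X₀, G₀) = {a ∈ G₀ | Xa = X}`. -/
def symmetryGroup (G₀ : Type u) [Group G₀] {X₀ : Type v} [MulAction G₀ᵐᵒᵖ X₀] (X : Set X₀) :
    Subgroup G₀ where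
  carrier := {a | X <• a = X}
  mul_mem' {a b} ha hb := by
    simp only [Set.mem_ofPred_eq] at *
    rw [← op_smul_op_smul, ha, hb]
  one_mem' := by simp
  inv_mem' {a} ha := by
    simp only [Set.mem_ofPred_eq] at *
    nth_rw 1 [← ha]
    simp

/-! Euclidean space with its groups acting from the right. -/

/-- The Euclidean space `ℝᵈ`. -/
abbrev Space (d : ℕ) : Type := EuclideanSpace ℝ (Fin d)

/-- The Euclidean group `E(d)` of all isometries of `ℝᵈ`, with the multiplication for which it acts
on `ℝᵈ` from the right: `x(ab) = (xa)b`. -/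
def EuclideanGroup (d : ℕ) : Type := (Space d ≃ᵃⁱ[ℝ] Space d)ᵐᵒᵖ

namespace EuclideanGroup

noncomputable instance (d : ℕ) : Group (EuclideanGroup d) :=
  inferInstanceAs (Group (Space d ≃ᵃⁱ[ℝ] Space d)ᵐᵒᵖ)

/-- The isometry `x ↦ xa`. -/
noncomputable def toIsometry {d : ℕ} (a : EuclideanGroup d) : Space d ≃ᵃⁱ[ℝ] Space d := MulOpposite.unop a

/-- The right action of `E(d)` on `ℝᵈ`. -/
noncomputable instance (d : ℕ) : MulAction (EuclideanGroup d)ᵐᵒᵖ (Space d) where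
  smul a x := toIsometry a.unop x
  one_smul _ := rfl
  mul_smul _ _ _ := rfl

theorem rightAct_def {d : ℕ} (x : Space d) (a : EuclideanGroup d) : x <• a = toIsometry a x := rfl

/-- The motion group `M(d)` of orientation preserving isometries of `ℝᵈ`. -/
noncomputable def motions (d : ℕ) : Subgroup (EuclideanGroup d) where
  carrier := {a | LinearMap.det
    ((toIsometry a).linearIsometryEquiv.toLinearEquiv : Space d →ₗ[ℝ] Space d) = 1}
  mul_mem' {a b} ha hb := by
    simp only [Set.mem_ofPred_eq] at *
    have : ((toIsometry (a * b)).linearIsometryEquiv.toLinearEquiv : Space d →ₗ[ℝ] Space d)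
        = ((toIsometry b).linearIsometryEquiv.toLinearEquiv : Space d →ₗ[ℝ] Space d) ∘ₗ
          ((toIsometry a).linearIsometryEquiv.toLinearEquiv : Space d →ₗ[ℝ] Space d) := rfl
    rw [this, LinearMap.det_comp, ha, hb, one_mul]
  one_mem' := LinearMap.det_id
  inv_mem' {a} ha := by
    simp only [Set.mem_ofPred_eq] at *
    have : ((toIsometry a⁻¹).linearIsometryEquiv.toLinearEquiv : Space d →ₗ[ℝ] Space d)
        = ((toIsometry a).linearIsometryEquiv.toLinearEquiv.symm : Space d →ₗ[ℝ] Space d) := rfl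
    have h2 := LinearEquiv.det_mul_det_symm (toIsometry a).linearIsometryEquiv.toLinearEquiv
    rw [this]
    rw [ha, one_mul] at h2
    exact h2

/-- A subgroup of `E(d)` acts on `ℝᵈ` from the right. -/
noncomputable instance {d : ℕ} (Γ : Subgroup (EuclideanGroup d)) : MulAction (Γ)ᵐᵒᵖ (Space d) :=
  MulAction.compHom (Space d) (MonoidHom.op Γ.subtype)

theorem subgroup_rightAct_def {d : ℕ} (Γ : Subgroup (EuclideanGroup d)) (x : Space d) (a : Γ) :
    x <• a = x <• (a : EuclideanGroup d) := rfl

end EuclideanGroup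

/-- The set `cc(F)` of connected components of `F`. -/
def components {d : ℕ} (F : Set (Space d)) : Set (Set (Space d)) :=
  {K | ∃ x ∈ F, K = connectedComponentIn F x}

theorem components_nonempty {d : ℕ} {F : Set (Space d)} (hF : F.Nonempty) :
    (components F).Nonempty := ⟨_, hF.choose, hF.choose_spec, rfl⟩

/-- The symmetry partial group `𝒫(cc(F), 𝔓(ℝᵈ), G₀)` of a figure `F` with respect to a group `G₀`
acting on `ℝᵈ` from the right: `𝒫(F)` for `G₀ = E(d)`, `S𝒫(F)` for `G₀ = M(d)`. -/
noncomputable def figureSymmetry (G₀ : Type) [Group G₀] {d : ℕ} [MulAction G₀ᵐᵒᵖ (Space d)]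
    (F : Set (Space d)) (hF : F.Nonempty) : PartialGroup.{0} :=
  parades G₀ (components F) (components_nonempty hF)

/-- A (right) action of a partial group `P` on a set `X` (a subset of an ambient type `T`).
`dom x w` says that `(x | w)` lies in `X𝒫ₙ`, `n` the length of `w`, and `act x w` is then
`◁ₙ(x | w)`; `n = 0` is included, with `X𝒫₀ = X` and `◁₀ = id`.  The values of `act` outside `dom`
carry no meaning and are never used. -/
structure PartialAction (P : PartialGroup.{u}) {T : Type v} (X : Set T) where
  dom : T → List P → Prop
  act : T → List P → T
  mem_of_dom : ∀ {x w}, dom x w → x ∈ X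
  word_mem : ∀ {x w}, dom x w → w ≠ [] → w ∈ P.dom
  act_mem : ∀ {x w}, dom x w → act x w ∈ X
  dom_nil : ∀ {x}, x ∈ X → dom x []
  act_nil : ∀ {x}, x ∈ X → act x [] = x
  dom_init : ∀ {x w a}, dom x (w ++ [a]) → dom x w
  dom_act : ∀ {x p q}, dom x (p ++ q) → dom (act x p) q
  act_act : ∀ {x p q}, dom x (p ++ q) → act (act x p) q = act x (p ++ q)
  dom_contract : ∀ {x p q r}, dom x (p ++ q ++ r) → q ≠ [] → dom x (p ++ [P.nabla q] ++ r)
  act_contract : ∀ {x p q r}, dom x (p ++ q ++ r) → q ≠ [] →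
    act x (p ++ [P.nabla q] ++ r) = act x (p ++ q ++ r)
  dom_insert_one : ∀ {x p q}, dom x (p ++ q) → dom x (p ++ [P.one] ++ q)
  act_one : ∀ {x}, x ∈ X → act x [P.one] = x
  dom_mul_inv : ∀ {x w}, dom x w → dom x (w ++ P.invWord w)

namespace PartialAction

theorem dom_left {P : PartialGroup.{u}} {T : Type v} {X : Set T} (S : PartialAction P X)
    {x : T} {p q : List P} (h : S.dom x (p ++ q)) : S.dom x p := by
  induction q using List.reverseRecOn with
  | nil => simpa using h
  | append_singleton q a ih => exact ih (S.dom_init (a := a) (by simpa using h))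

theorem erase_one {P : PartialGroup.{u}} {T : Type v} {X : Set T} (S : PartialAction P X)
    {x : T} {p r : List P} (h : S.dom x (p ++ [P.one] ++ r)) :
    S.dom x (p ++ r) ∧ S.act x (p ++ [P.one] ++ r) = S.act x (p ++ r) := by
  rcases List.eq_nil_or_concat p with rfl | ⟨p', a, rfl⟩
  · cases r with
    | nil =>
      have hx := S.mem_of_dom h
      exact ⟨S.dom_nil hx, (S.act_one hx).trans (S.act_nil hx).symm⟩
    | cons b r =>
      have h' : S.dom x ([] ++ [P.one, b] ++ r) := by simpa using h
      have m := S.dom_contract h' (by simp)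
      have e := S.act_contract h' (by simp)
      rw [P.nabla_one_left] at m e
      exact ⟨by simpa using m, by simpa using e.symm⟩
  · have h' : S.dom x (p' ++ [a, P.one] ++ r) := by simpa using h
    have m := S.dom_contract h' (by simp)
    have e := S.act_contract h' (by simp)
    rw [P.nabla_one_right] at m e
    exact ⟨by simpa using m, by simpa using e.symm⟩

theorem act_insert_one {P : PartialGroup.{u}} {T : Type v} {X : Set T} (S : PartialAction P X)
    {x : T} {p r : List P} (h : S.dom x (p ++ r)) :
    S.act x (p ++ [P.one] ++ r) = S.act x (p ++ r) :=
  (S.erase_one (S.dom_insert_one h)).2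

theorem erase_word {P : PartialGroup.{u}} {T : Type v} {X : Set T} (S : PartialAction P X)
    {x : T} {p w r : List P} (h : S.dom x (p ++ (w ++ P.invWord w) ++ r)) :
    S.dom x (p ++ r) ∧ S.act x (p ++ (w ++ P.invWord w) ++ r) = S.act x (p ++ r) := by
  induction w using List.reverseRecOn with
  | nil => simpa using h
  | append_singleton w a ih =>
    have e0 : p ++ (w ++ [a] ++ P.invWord (w ++ [a])) ++ r
        = (p ++ w) ++ [a, P.inv a] ++ (P.invWord w ++ r) := by
      simp [P.invWord_append, P.invWord_singleton]
    rw [e0] at h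
    have m := S.dom_contract h (by simp)
    have e := S.act_contract h (by simp)
    rw [P.nabla_mul_inv] at m e
    have h2 := S.erase_one m
    have e1 : p ++ w ++ (P.invWord w ++ r) = p ++ (w ++ P.invWord w) ++ r := by simp
    rw [e1] at h2
    have h3 := ih h2.1
    exact ⟨h3.1, by rw [e0, ← e, h2.2, h3.2]⟩

theorem dom_back {P : PartialGroup.{u}} {T : Type v} {X : Set T} (S : PartialAction P X)
    {x : T} {p q : List P} (h : S.dom x (p ++ q)) :
    S.dom (S.act x p) (P.invWord p ++ p ++ q) := by
  have h1 := S.dom_mul_inv (S.dom_mul_inv h)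
  have e1 : p ++ q ++ P.invWord (p ++ q) ++ P.invWord (p ++ q ++ P.invWord (p ++ q))
      = (p ++ (q ++ P.invWord q) ++ (P.invWord p ++ p ++ q)) ++ P.invWord (p ++ q) := by
    simp [P.invWord_append, P.invWord_invWord]
  rw [e1] at h1
  exact S.dom_act (S.erase_word (S.dom_left h1)).1

theorem act_back_append {P : PartialGroup.{u}} {T : Type v} {X : Set T} (S : PartialAction P X)
    {x : T} {p q : List P} (h : S.dom x (p ++ q)) :
    S.act (S.act x p) (P.invWord p ++ p ++ q) = S.act x (p ++ q) := by
  have h1 := S.dom_mul_inv (S.dom_mul_inv h)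
  have e1 : p ++ q ++ P.invWord (p ++ q) ++ P.invWord (p ++ q ++ P.invWord (p ++ q))
      = (p ++ (q ++ P.invWord q) ++ (P.invWord p ++ p ++ q)) ++ P.invWord (p ++ q) := by
    simp [P.invWord_append, P.invWord_invWord]
  rw [e1] at h1
  have h2 := (S.erase_word (S.dom_left h1)).1
  rw [S.act_act h2]
  have e2 : p ++ (P.invWord p ++ p ++ q) = [] ++ (p ++ P.invWord p) ++ (p ++ q) := by simp
  rw [e2] at h2 ⊢
  exact (S.erase_word h2).2

theorem act_back {P : PartialGroup.{u}} {T : Type v} {X : Set T} (S : PartialAction P X)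
    {x : T} {p : List P} (h : S.dom x p) :
    S.dom (S.act x p) (P.invWord p) ∧ S.act (S.act x p) (P.invWord p) = x := by
  have h1 := S.dom_mul_inv h
  refine ⟨S.dom_act h1, ?_⟩
  rw [S.act_act h1]
  have h2 : S.dom x ([] ++ (p ++ P.invWord p) ++ []) := by simpa using h1
  have := (S.erase_word h2).2
  simp only [List.nil_append, List.append_nil] at this
  rw [this, S.act_nil (S.mem_of_dom h)]

end PartialAction

namespace PartialGroup

/-- Replace the `k` letters of `w` that follow the first `i` ones by their product. -/
def contract (P : PartialGroup.{u}) (i k : ℕ) (w : List P) : List P :=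
  w.take i ++ [P.nabla ((w.drop i).take k)] ++ w.drop (i + k)

/-- Insert the unit into `w` after the first `i` letters. -/
def insertOne (P : PartialGroup.{u}) (i : ℕ) (w : List P) : List P :=
  w.take i ++ [P.one] ++ w.drop i

end PartialGroup

/-- The structure of a (right) `F`-partial group on a partial group `H`: an action of `F` on each
of the sets `H_r` of words of length `r` of `H` (that is, an action on all words of `H` that
preserves the length), such that removing the first or the last letter, multiplying consecutive
letters, inserting the unit, and `η ↦ η × η⁻¹`, `η ↦ η⁻¹ × η` are maps of `F`-sets, and such that
all words of `F` act on the unit of `H` and fix it. -/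
structure PartialGroupAction (F H : PartialGroup.{u}) extends PartialAction F H.dom where
  length_act : ∀ {η γ}, dom η γ → (act η γ).length = η.length
  dom_tail : ∀ {η γ}, dom η γ → 1 < η.length → dom η.tail γ
  act_tail : ∀ {η γ}, dom η γ → 1 < η.length → act η.tail γ = (act η γ).tail
  dom_dropLast : ∀ {η γ}, dom η γ → 1 < η.length → dom η.dropLast γ
  act_dropLast : ∀ {η γ}, dom η γ → 1 < η.length → act η.dropLast γ = (act η γ).dropLast
  dom_mul : ∀ {η γ} (i k : ℕ), dom η γ → 0 < k → i + k ≤ η.length → dom (H.contract i k η) γ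
  act_mul : ∀ {η γ} (i k : ℕ), dom η γ → 0 < k → i + k ≤ η.length →
    act (H.contract i k η) γ = H.contract i k (act η γ)
  dom_unit : ∀ {η γ} (i : ℕ), dom η γ → i ≤ η.length → dom (H.insertOne i η) γ
  act_unit : ∀ {η γ} (i : ℕ), dom η γ → i ≤ η.length →
    act (H.insertOne i η) γ = H.insertOne i (act η γ)
  dom_one : ∀ {γ}, γ ∈ F.dom → dom [H.one] γ
  act_fix_one : ∀ {γ}, γ ∈ F.dom → act [H.one] γ = [H.one]
  dom_append_inv : ∀ {η γ}, dom η γ → dom (η ++ H.invWord η) γ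
  act_append_inv : ∀ {η γ}, dom η γ →
    act (η ++ H.invWord η) γ = act η γ ++ H.invWord (act η γ)
  dom_inv_append : ∀ {η γ}, dom η γ → dom (H.invWord η ++ η) γ
  act_inv_append : ∀ {η γ}, dom η γ →
    act (H.invWord η ++ η) γ = H.invWord (act η γ) ++ act η γ

namespace PartialGroupAction

/-- The element `◁(h | γ)` of `H₁`. -/
def actOne {F H : PartialGroup.{u}} (S : PartialGroupAction F H) (h : H) (γ : List F) : H :=
  (S.act [h] γ).headD h

/-- The word `A(α) = (◁(η₁ | γ₂, …, γₙ), ◁(η₂ | γ₃, …, γₙ), …, ◁(ηₙ₋₁ | γₙ), ηₙ)` of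
`α = (γ₁ ⋉ η₁, …, γₙ ⋉ ηₙ)`. -/
def wordA {F H : PartialGroup.{u}} (S : PartialGroupAction F H) : List (F × H) → List H
  | [] => []
  | a :: α => S.actOne a.2 (α.map Prod.fst) :: S.wordA α

/-- The condition `(ηⱼ | γⱼ₊₁, …, γₙ) ∈ H₁Fₙ₋ⱼ` for all `j`, for `α = (γ₁ ⋉ η₁, …, γₙ ⋉ ηₙ)`. -/
def Composable {F H : PartialGroup.{u}} (S : PartialGroupAction F H) : List (F × H) → Prop
  | [] => True
  | a :: α => S.dom [a.2] (α.map Prod.fst) ∧ S.Composable α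

/-- The words of the semidirect product `F ⋉ H`: the words `α` as above with
`A⁺(α) = (A(α) | γₙ⁻¹, …, γ₁⁻¹) ∈ HₙFₙ`. -/
def semidirectDom {F H : PartialGroup.{u}} (S : PartialGroupAction F H) : Set (List (F × H)) :=
  {α | α ≠ [] ∧ S.Composable α ∧ S.dom (S.wordA α) (F.invWord (α.map Prod.fst))}

section lemmas

variable {F H : PartialGroup.{u}} (S : PartialGroupAction F H)

theorem act_singleton {h : H} {γ : List F} (hd : S.dom [h] γ) : S.act [h] γ = [S.actOne h γ] := by
  have := S.length_act hd
  obtain ⟨y, hy⟩ := List.length_eq_one_iff.1 this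
  simp [actOne, hy]

theorem dom_suffix {p q : List H} {γ : List F} (h : S.dom (p ++ q) γ) (hq : q ≠ []) :
    S.dom q γ ∧ S.act q γ = (S.act (p ++ q) γ).drop p.length := by
  induction p with
  | nil => exact ⟨by simpa using h, by simp⟩
  | cons a p ih =>
    have hl : 1 < (a :: p ++ q).length := by
      have := List.length_pos_iff.2 hq
      simp; omega
    have h1 := S.dom_tail h hl
    have h2 := S.act_tail h hl
    obtain ⟨h3, h4⟩ := ih (by simpa using h1)
    refine ⟨h3, ?_⟩
    simp only [List.cons_append, List.tail_cons] at h2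
    rw [h4, h2]
    simp [List.drop_tail]

theorem dom_prefix {p q : List H} {γ : List F} (h : S.dom (p ++ q) γ) (hp : p ≠ []) :
    S.dom p γ ∧ S.act p γ = (S.act (p ++ q) γ).take p.length := by
  induction q using List.reverseRecOn with
  | nil =>
    have := S.length_act h
    refine ⟨by simpa using h, ?_⟩
    simp only [List.append_nil] at this ⊢
    rw [List.take_of_length_le this.le]
  | append_singleton q a ih =>
    have hl : 1 < (p ++ (q ++ [a])).length := by
      have := List.length_pos_iff.2 hp
      simp; omega
    have h1 := S.dom_dropLast h hl
    have h2 := S.act_dropLast h hl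
    have e : (p ++ (q ++ [a])).dropLast = p ++ q := by
      rw [← List.append_assoc, List.dropLast_concat]
    rw [e] at h1 h2
    obtain ⟨h3, h4⟩ := ih h1
    refine ⟨h3, ?_⟩
    have hlen := S.length_act h
    rw [h4, h2, List.dropLast_eq_take, List.take_take]
    congr 1
    rw [hlen]; simp

theorem act_eq_map {η : List H} {γ : List F} (h : S.dom η γ) :
    (∀ x ∈ η, S.dom [x] γ) ∧ S.act η γ = η.map (fun x => S.actOne x γ) := by
  induction η with
  | nil => exact absurd rfl (H.ne_nil (S.mem_of_dom h))
  | cons a η ih =>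
    have h1 : S.dom ([a] ++ η) γ := h
    obtain ⟨ha, ea⟩ := S.dom_prefix h1 (by simp)
    rw [S.act_singleton ha] at ea
    have hlen := S.length_act h
    by_cases hη : η = []
    · subst hη
      refine ⟨by simpa using ha, ?_⟩
      rw [S.act_singleton ha]; rfl
    · obtain ⟨hη1, eη⟩ := S.dom_suffix h1 hη
      obtain ⟨ih1, ih2⟩ := ih hη1
      refine ⟨by simpa [ha] using ih1, ?_⟩
      have : S.act (a :: η) γ = (S.act (a :: η) γ).take 1 ++ (S.act (a :: η) γ).drop 1 :=
        (List.take_append_drop _ _).symm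
      rw [this]
      simp only [List.length_singleton, List.cons_append, List.nil_append] at ea eη
      rw [← ea, ← eη, ih2]
      rfl

theorem actOne_append {h : H} {p q : List F} (hd : S.dom [h] (p ++ q)) :
    S.dom [h] p ∧ S.dom [S.actOne h p] q ∧ S.actOne (S.actOne h p) q = S.actOne h (p ++ q) := by
  have h1 := S.dom_left hd
  have h2 := S.dom_act hd
  have h3 := S.act_act hd
  rw [S.act_singleton h1] at h2 h3
  rw [S.act_singleton h2, S.act_singleton hd] at h3
  exact ⟨h1, h2, by simpa using h3⟩

theorem actOne_back {h : H} {p : List F} (hd : S.dom [h] p) :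
    S.actOne (S.actOne h p) (F.invWord p) = h := by
  have h1 := S.act_back hd
  rw [S.act_singleton hd] at h1
  rw [S.act_singleton h1.1] at h1
  simpa using h1.2

theorem actOne_nil (h : H) : S.actOne h [] = h := by
  have := S.act_nil (H.singleton_mem h)
  simp [actOne, this]

theorem length_wordA (α : List (F × H)) : (S.wordA α).length = α.length := by
  induction α with
  | nil => rfl
  | cons a α ih => simp [wordA, ih]

theorem wordA_append {p q : List (F × H)} (h : S.Composable (p ++ q)) :
    S.Composable p ∧ S.Composable q ∧ (∀ x ∈ S.wordA p, S.dom [x] (q.map Prod.fst)) ∧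
    S.wordA (p ++ q) = (S.wordA p).map (fun x => S.actOne x (q.map Prod.fst)) ++ S.wordA q := by
  induction p with
  | nil => exact ⟨trivial, h, by simp [wordA], by simp [wordA]⟩
  | cons a p ih =>
    obtain ⟨h1, h2⟩ := h
    obtain ⟨i1, i2, i3, i4⟩ := ih h2
    change S.dom [a.2] ((p ++ q).map Prod.fst) at h1
    rw [List.map_append] at h1
    obtain ⟨j1, j2, j3⟩ := S.actOne_append h1
    refine ⟨⟨j1, i1⟩, i2, ?_, ?_⟩
    · intro x hx
      rcases List.mem_cons.1 hx with rfl | hx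
      · exact j2
      · exact i3 x hx
    · change S.actOne a.2 ((p ++ q).map Prod.fst) :: S.wordA (p ++ q) = _
      rw [i4, List.map_append, ← j3]
      rfl

theorem actOne_inv {h : H} {γ : List F} (hd : S.dom [h] γ) :
    S.dom [H.inv h] γ ∧ S.actOne (H.inv h) γ = H.inv (S.actOne h γ) := by
  have h1 := S.dom_append_inv hd
  have h2 := S.act_append_inv hd
  obtain ⟨h3, h4⟩ := S.dom_suffix (p := [h]) h1 (by simp [PartialGroup.invWord])
  rw [h2, S.act_singleton hd] at h4
  change S.dom [H.inv h] γ at h3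
  change S.act [H.inv h] γ = _ at h4
  rw [S.act_singleton h3] at h4
  exact ⟨h3, by simpa [PartialGroup.invWord] using h4⟩

theorem dom_letters {h : H} {p q : List F} (hd : S.dom [h] (p ++ q)) :
    S.dom [S.actOne h p] (F.invWord p ++ p ++ q) ∧
    S.actOne (S.actOne h p) (F.invWord p ++ p ++ q) = S.actOne h (p ++ q) := by
  have h1 := S.dom_back hd
  have h2 := S.act_back_append hd
  have h3 := S.dom_left hd
  rw [S.act_singleton h3] at h1 h2
  rw [S.act_singleton h1, S.act_singleton hd] at h2
  exact ⟨h1, by simpa using h2⟩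

theorem replace_middle {p q r : List (F × H)} {c : F × H} (hα : S.Composable (p ++ q ++ r))
    (hc : S.dom [c.2] (r.map Prod.fst))
    (hx : ∀ (x : H) (u : List F), S.dom [x] (u ++ q.map Prod.fst ++ r.map Prod.fst) →
      S.dom [x] (u ++ [c.1] ++ r.map Prod.fst) ∧ S.actOne x (u ++ [c.1] ++ r.map Prod.fst)
        = S.actOne x (u ++ q.map Prod.fst ++ r.map Prod.fst)) :
    S.Composable (p ++ [c] ++ r) ∧ S.wordA (p ++ [c] ++ r) =
      (S.wordA (p ++ q ++ r)).take p.length ++ [S.actOne c.2 (r.map Prod.fst)] ++ S.wordA r := by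
  induction p with
  | nil =>
    have := (S.wordA_append (p := q) (q := r) (by simpa using hα)).2.1
    exact ⟨⟨hc, this⟩, by simp [wordA]⟩
  | cons a p ih =>
    obtain ⟨h1, h2⟩ := hα
    obtain ⟨i1, i2⟩ := ih h2
    change S.dom [a.2] ((p ++ q ++ r).map Prod.fst) at h1
    rw [List.map_append, List.map_append] at h1
    obtain ⟨j1, j2⟩ := hx _ _ h1
    refine ⟨⟨?_, i1⟩, ?_⟩
    · change S.dom [a.2] ((p ++ [c] ++ r).map Prod.fst)
      simpa using j1
    · change S.actOne a.2 ((p ++ [c] ++ r).map Prod.fst) :: S.wordA (p ++ [c] ++ r) =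
        (S.actOne a.2 ((p ++ q ++ r).map Prod.fst) :: S.wordA (p ++ q ++ r)).take (p.length + 1)
          ++ [S.actOne c.2 (r.map Prod.fst)] ++ S.wordA r
      rw [i2]
      simp only [List.map_append, List.map_cons, List.map_nil, List.take_succ_cons]
      rw [j2]
      rfl

theorem semidirect_right {p q : List (F × H)} (h : p ++ q ∈ S.semidirectDom) (hq : q ≠ []) :
    q ∈ S.semidirectDom := by
  obtain ⟨-, h1, h2⟩ := h
  obtain ⟨a1, a2, a3, a4⟩ := S.wordA_append h1
  refine ⟨hq, a2, ?_⟩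
  rw [a4, List.map_append, F.invWord_append] at h2
  refine (S.dom_suffix (S.dom_left h2) ?_).1
  intro e
  have := congrArg List.length e
  rw [S.length_wordA] at this
  exact hq (List.length_eq_zero_iff.1 this)

theorem semidirect_left {p q : List (F × H)} (h : p ++ q ∈ S.semidirectDom) (hp : p ≠ []) :
    p ∈ S.semidirectDom ∧ S.dom (S.wordA p) (q.map Prod.fst) := by
  obtain ⟨-, h1, h2⟩ := h
  obtain ⟨a1, a2, a3, a4⟩ := S.wordA_append h1
  rw [a4, List.map_append, F.invWord_append] at h2
  have e := (S.act_eq_map (S.dom_left h2)).2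
  rw [List.map_append, List.map_map] at e
  have e1 : (S.wordA p).map ((fun x => S.actOne x (F.invWord (q.map Prod.fst))) ∘
      fun x => S.actOne x (q.map Prod.fst)) = S.wordA p := by
    conv_rhs => rw [← List.map_id (S.wordA p)]
    exact List.map_congr_left fun x hx => S.actOne_back (a3 x hx)
  rw [e1] at e
  have hne : S.wordA p ≠ [] := by
    intro e
    have := congrArg List.length e
    rw [S.length_wordA] at this
    exact hp (List.length_eq_zero_iff.1 this)
  have k1 := S.dom_act h2
  rw [e] at k1
  have k2 := (S.act_back (S.dom_left h2)).1
  rw [e, F.invWord_invWord] at k2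
  exact ⟨⟨hp, a1, (S.dom_prefix k1 hne).1⟩, (S.dom_prefix k2 hne).1⟩

theorem semidirect_singleton {a : F × H} :
    [a] ∈ S.semidirectDom ↔ S.dom [a.2] [F.inv a.1] := by
  constructor
  · rintro ⟨-, -, h⟩
    change S.dom [S.actOne a.2 []] [F.inv a.1] at h
    rwa [S.actOne_nil] at h
  · intro h
    refine ⟨by simp, ⟨S.dom_nil (H.singleton_mem _), trivial⟩, ?_⟩
    change S.dom [S.actOne a.2 []] [F.inv a.1]
    rwa [S.actOne_nil]

/-- The inverse `γ⁻¹ ⋉ ◁(η | γ⁻¹)⁻¹` of `γ ⋉ η`. -/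
def semidirectInv (a : F × H) : F × H := (F.inv a.1, H.inv (S.actOne a.2 [F.inv a.1]))

/-- The product `∇(γ₁, …, γₙ) ⋉ ∇(A(α))` of `α = (γ₁ ⋉ η₁, …, γₙ ⋉ ηₙ)`. -/
def semidirectNabla (α : List (F × H)) : F × H :=
  (F.nabla (α.map Prod.fst), H.nabla (S.wordA α))

theorem semidirectInv_semidirectInv {a : F × H} (h : [a] ∈ S.semidirectDom) :
    S.semidirectInv (S.semidirectInv a) = a := by
  rw [semidirect_singleton] at h
  have h0 := S.act_back h
  have h1 : S.dom [S.actOne a.2 [F.inv a.1]] [F.inv (F.inv a.1)] := by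
    have := h0.1
    rwa [S.act_singleton h] at this
  have h2 := S.actOne_back h
  refine Prod.ext (F.inv_inv _) ?_
  change H.inv (S.actOne (H.inv (S.actOne a.2 [F.inv a.1])) [F.inv (F.inv a.1)]) = a.2
  rw [(S.actOne_inv h1).2, H.inv_inv]
  exact h2

theorem map_fst_inv (α : List (F × H)) :
    ((α.map S.semidirectInv).reverse).map Prod.fst = F.invWord (α.map Prod.fst) := by
  rw [PartialGroup.invWord, List.map_reverse, List.map_map, List.map_map]
  rfl

theorem wordA_ne_nil {α : List (F × H)} (h : α ≠ []) : S.wordA α ≠ [] := by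
  intro e
  have := congrArg List.length e
  rw [S.length_wordA] at this
  exact h (List.length_eq_zero_iff.1 this)

theorem append_inverse_aux {α κ : List (F × H)} {r : List F} (hα : S.Composable α)
    (hκ : S.Composable κ) (e : κ.map Prod.fst = F.invWord (α.map Prod.fst) ++ r)
    (h : ∀ x ∈ S.wordA α, S.dom [x] (κ.map Prod.fst)) :
    S.Composable (α ++ κ) := by
  induction α generalizing r with
  | nil => exact hκ
  | cons a α ih =>
    rw [List.map_cons, F.invWord_cons, List.append_assoc] at e
    refine ⟨?_, ih hα.2 e (fun x hx => h x (List.mem_cons_of_mem _ hx))⟩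
    have h1 : S.dom [S.actOne a.2 (α.map Prod.fst)] (κ.map Prod.fst) :=
      h _ (List.mem_cons_self ..)
    have h2 := S.actOne_back hα.1
    rw [e] at h1
    have h3 := (S.dom_letters h1).1
    rw [h2, F.invWord_invWord] at h3
    rw [show α.append κ = α ++ κ from rfl, List.map_append, e]
    simpa using h3

theorem inverse_aux {α : List (F × H)} (hα : S.Composable α)
    (h : ∀ x ∈ S.wordA α, S.dom [x] (F.invWord (α.map Prod.fst))) :
    S.Composable (α.map S.semidirectInv).reverse ∧ S.wordA (α.map S.semidirectInv).reverse =
      H.invWord ((S.wordA α).map fun x => S.actOne x (F.invWord (α.map Prod.fst))) := by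
  induction α using List.reverseRecOn with
  | nil => exact ⟨trivial, rfl⟩
  | append_singleton β a ih =>
    obtain ⟨a1, a2, a3, a4⟩ := S.wordA_append hα
    have hA : S.wordA [a] = [a.2] := by
      change [S.actOne a.2 []] = _
      rw [S.actOne_nil]
    have hγ : F.invWord ((β ++ [a]).map Prod.fst)
        = [F.inv a.1] ++ F.invWord (β.map Prod.fst) := by
      rw [List.map_append, F.invWord_append]; rfl
    rw [a4, hA, hγ] at h
    have hx : ∀ x ∈ S.wordA β, S.dom [x] (F.invWord (β.map Prod.fst)) ∧
        S.actOne (S.actOne x [a.1]) ([F.inv a.1] ++ F.invWord (β.map Prod.fst))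
          = S.actOne x (F.invWord (β.map Prod.fst)) := by
      intro x hx
      have h1 := h (S.actOne x [a.1]) (List.mem_append_left _ (List.mem_map_of_mem hx))
      obtain ⟨b1, b2, b3⟩ := S.actOne_append h1
      have b4 : S.actOne (S.actOne x [a.1]) [F.inv a.1] = x := S.actOne_back (a3 x hx)
      rw [b4] at b2 b3
      exact ⟨b2, b3.symm⟩
    obtain ⟨i1, i2⟩ := ih a1 (fun x h => (hx x h).1)
    have h2 := h a.2 (by simp)
    obtain ⟨c1, c2, c3⟩ := S.actOne_append h2
    obtain ⟨d1, d2⟩ := S.actOne_inv c2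
    rw [List.map_append, List.reverse_append]
    refine ⟨⟨?_, i1⟩, ?_⟩
    · change S.dom [H.inv (S.actOne a.2 [F.inv a.1])] (((β.map S.semidirectInv).reverse).map Prod.fst)
      rw [S.map_fst_inv]
      exact d1
    · change S.actOne (H.inv (S.actOne a.2 [F.inv a.1])) (((β.map S.semidirectInv).reverse).map Prod.fst)
        :: S.wordA (β.map S.semidirectInv).reverse = _
      rw [S.map_fst_inv, d2, c3, i2, a4, hA, hγ, List.map_append, H.invWord_append, List.map_map]
      have : (S.wordA β).map ((fun x => S.actOne x ([F.inv a.1] ++ F.invWord (β.map Prod.fst))) ∘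
          fun x => S.actOne x ([a].map Prod.fst))
          = (S.wordA β).map (fun x => S.actOne x (F.invWord (β.map Prod.fst))) :=
        List.map_congr_left fun x h => (hx x h).2
      rw [this]
      rfl

theorem append_inverse {α : List (F × H)} (h : α ∈ S.semidirectDom) :
    α ++ (α.map S.semidirectInv).reverse ∈ S.semidirectDom := by
  obtain ⟨h0, h1, h2⟩ := h
  obtain ⟨e1, e2⟩ := S.act_eq_map h2
  obtain ⟨i1, i2⟩ := S.inverse_aux h1 e1
  have hγ := S.map_fst_inv α
  have hc : S.Composable (α ++ (α.map S.semidirectInv).reverse) :=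
    S.append_inverse_aux (r := []) h1 i1 (by rw [hγ, List.append_nil])
      (fun x hx => by rw [hγ]; exact e1 x hx)
  refine ⟨by simp [h0], hc, ?_⟩
  obtain ⟨-, -, -, a4⟩ := S.wordA_append hc
  rw [a4, hγ, i2, ← e2, List.map_append, hγ, F.invWord_append, F.invWord_invWord]
  have := S.dom_back (p := F.invWord (α.map Prod.fst)) (q := []) (by simpa using h2)
  rw [F.invWord_invWord, List.append_nil] at this
  exact S.dom_append_inv this

theorem semidirect_contract {p q r : List (F × H)} (h : p ++ q ++ r ∈ S.semidirectDom)
    (hq : q ≠ []) :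
    p ++ [S.semidirectNabla q] ++ r ∈ S.semidirectDom ∧
    S.semidirectNabla (p ++ [S.semidirectNabla q] ++ r) = S.semidirectNabla (p ++ q ++ r) := by
  have hqr : q ++ r ∈ S.semidirectDom :=
    S.semidirect_right (p := p) (by simpa using h) (by simp [hq])
  obtain ⟨hqd, hqr'⟩ := S.semidirect_left hqr hq
  obtain ⟨-, h1, h2⟩ := h
  obtain ⟨b1, b2, b3, b4⟩ := S.wordA_append hqr.2.1
  obtain ⟨c1, c2, c3, c4⟩ := S.wordA_append (p := p) (q := q ++ r) (by simpa using h1)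
  have hlen := S.length_wordA q
  have hpos := List.length_pos_iff.2 hq
  have hcon : ∀ w : List H, w.length = q.length → H.contract 0 q.length w = [H.nabla w] := by
    intro w hw
    simp [PartialGroup.contract, ← hw]
  have m1 := S.dom_mul 0 q.length hqr' hpos (by omega)
  have m2 := S.act_mul 0 q.length hqr' hpos (by omega)
  rw [hcon _ hlen] at m1 m2
  rw [hcon _ (by rw [S.length_act hqr', hlen]), S.act_singleton m1, (S.act_eq_map hqr').2] at m2
  have m2' : S.actOne (H.nabla (S.wordA q)) (r.map Prod.fst) =
      H.nabla ((S.wordA q).map fun x => S.actOne x (r.map Prod.fst)) := by simpa using m2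
  have hqF : q.map Prod.fst ∈ F.dom := by
    have := F.invWord_mem (S.word_mem hqd.2.2 (F.invWord_ne_nil (by simpa using hq)))
    rwa [F.invWord_invWord] at this
  have hqF0 : q.map Prod.fst ≠ [] := by simpa using hq
  obtain ⟨d1, d2⟩ := S.replace_middle (c := S.semidirectNabla q) h1 m1 (by
    intro x u hx
    refine ⟨S.dom_contract hx hqF0, ?_⟩
    have e := S.act_contract hx hqF0
    have e' := S.dom_contract hx hqF0
    rw [S.act_singleton hx, S.act_singleton e'] at e
    exact (List.cons.inj e).1)
  have hA : S.wordA (p ++ [S.semidirectNabla q] ++ r)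
      = H.contract p.length q.length (S.wordA (p ++ q ++ r)) := by
    rw [d2]
    have e : S.wordA (p ++ q ++ r) = (S.wordA p).map (fun x => S.actOne x ((q ++ r).map Prod.fst)) ++
        ((S.wordA q).map (fun x => S.actOne x (r.map Prod.fst)) ++ S.wordA r) := by
      rw [List.append_assoc, c4, b4]
    have lp : ((S.wordA p).map (fun x => S.actOne x ((q ++ r).map Prod.fst))).length = p.length := by
      rw [List.length_map, S.length_wordA]
    have lq : ((S.wordA q).map (fun x => S.actOne x (r.map Prod.fst))).length = q.length := by
      rw [List.length_map, S.length_wordA]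
    rw [e]
    generalize (S.wordA p).map (fun x => S.actOne x ((q ++ r).map Prod.fst)) = P' at *
    change _ ++ [S.actOne (H.nabla (S.wordA q)) (r.map Prod.fst)] ++ _ = _
    rw [m2']
    generalize (S.wordA q).map (fun x => S.actOne x (r.map Prod.fst)) = Q' at *
    simp [PartialGroup.contract, ← lp, ← lq, List.drop_append]
  have hlen3 := S.length_wordA (p ++ q ++ r)
  simp only [List.length_append] at hlen3
  have hdom : S.dom (S.wordA (p ++ [S.semidirectNabla q] ++ r)) (F.invWord ((p ++ q ++ r).map Prod.fst)) := by
    rw [hA]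
    exact S.dom_mul _ _ h2 hpos (by omega)
  refine ⟨⟨by simp, d1, ?_⟩, ?_⟩
  · rw [List.map_append, List.map_append, F.invWord_append, F.invWord_append, ← List.append_assoc] at hdom
    have := S.dom_contract hdom (F.invWord_ne_nil hqF0)
    rw [F.nabla_invWord hqF] at this
    rw [List.map_append, List.map_append, F.invWord_append, F.invWord_append, ← List.append_assoc]
    exact this
  · have hF : p.map Prod.fst ++ q.map Prod.fst ++ r.map Prod.fst ∈ F.dom := by
      have := F.invWord_mem (S.word_mem h2 (F.invWord_ne_nil (by simp [hq])))
      rw [F.invWord_invWord] at this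
      simpa using this
    refine Prod.ext ?_ ?_
    · have := F.nabla_contract hF hqF0
      simpa [semidirectNabla] using this
    · change H.nabla (S.wordA (p ++ [S.semidirectNabla q] ++ r)) = H.nabla (S.wordA (p ++ q ++ r))
      rw [hA]
      generalize S.wordA (p ++ q ++ r) = W at *
      have hW := S.mem_of_dom h2
      have e : W = W.take p.length ++ (W.drop p.length).take q.length ++ W.drop (p.length + q.length) := by
        rw [List.append_assoc, ← List.drop_drop, List.take_append_drop, List.take_append_drop]
      have k : (W.drop p.length).take q.length ≠ [] := by
        intro e
        have := congrArg List.length e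
        simp only [List.length_take, List.length_drop, List.length_nil] at this
        omega
      have := H.nabla_contract (p := W.take p.length) (q := (W.drop p.length).take q.length)
        (r := W.drop (p.length + q.length)) (by rw [← e]; exact hW) k
      rw [← e] at this
      exact this

theorem semidirect_insert_one {p q : List (F × H)} (h : p ++ q ∈ S.semidirectDom) :
    p ++ [(F.one, H.one)] ++ q ∈ S.semidirectDom := by
  obtain ⟨h0, h1, h2⟩ := h
  have hF : p.map Prod.fst ++ q.map Prod.fst ∈ F.dom := by
    have := F.invWord_mem (S.word_mem h2 (F.invWord_ne_nil (by simpa using h0)))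
    rw [F.invWord_invWord] at this
    simpa using this
  have hone : S.dom [H.one] (q.map Prod.fst) ∧ S.actOne H.one (q.map Prod.fst) = H.one := by
    by_cases hq : q.map Prod.fst = []
    · rw [hq]; exact ⟨S.dom_nil (H.singleton_mem _), S.actOne_nil _⟩
    · have hm := F.right_mem hF hq
      have e := S.act_fix_one hm
      rw [S.act_singleton (S.dom_one hm)] at e
      exact ⟨S.dom_one hm, by simpa using e⟩
  obtain ⟨d1, d2⟩ := S.replace_middle (p := p) (q := []) (r := q) (c := (F.one, H.one))
    (by simpa using h1) hone.1 (by
      intro x u hx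
      have hx' : S.dom [x] (u ++ q.map Prod.fst) := by simpa using hx
      have e := S.act_insert_one hx'
      have e' := S.dom_insert_one hx'
      rw [S.act_singleton hx', S.act_singleton e'] at e
      exact ⟨e', by simpa using e⟩)
  rw [hone.2] at d2
  have hlen := S.length_wordA (p ++ q)
  obtain ⟨-, -, -, a4⟩ := S.wordA_append h1
  have hA : S.wordA (p ++ [(F.one, H.one)] ++ q) = H.insertOne p.length (S.wordA (p ++ q)) := by
    rw [d2]
    simp only [List.append_nil]
    have lp : ((S.wordA p).map (fun x => S.actOne x (q.map Prod.fst))).length = p.length := by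
      rw [List.length_map, S.length_wordA]
    rw [a4]
    generalize (S.wordA p).map (fun x => S.actOne x (q.map Prod.fst)) = P' at *
    simp [PartialGroup.insertOne, ← lp]
  refine ⟨by simp, d1, ?_⟩
  have k := S.dom_unit p.length h2 (by rw [hlen]; simp)
  rw [← hA, List.map_append, F.invWord_append] at k
  have := S.dom_insert_one k
  rw [List.map_append, List.map_append, F.invWord_append, F.invWord_append, ← List.append_assoc]
  change S.dom _ (_ ++ [F.inv F.one] ++ _)
  rw [F.inv_one]
  exact this

end lemmas

/-- The system of words of the semidirect product `F ⋉ H`. -/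
def semidirectSystem {F H : PartialGroup.{u}} (S : PartialGroupAction F H) :
    WordSystem (F × H) where
  dom := S.semidirectDom
  nabla := S.semidirectNabla
  one := (F.one, H.one)
  inv := S.semidirectInv
  ne_nil h := h.1
  nabla_singleton a := by
    refine Prod.ext (F.nabla_singleton _) ?_
    change H.nabla [S.actOne a.2 []] = a.2
    rw [S.actOne_nil, H.nabla_singleton]
  tail_mem {a w} h hw := S.semidirect_right (p := [a]) h hw
  init_mem h hw := (S.semidirect_left h hw).1
  contract_mem h hq := (S.semidirect_contract h hq).1
  nabla_contract h hq := (S.semidirect_contract h hq).2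
  one_mem := by
    rw [semidirect_singleton]
    change S.dom [H.one] [F.inv F.one]
    exact S.dom_one (F.singleton_mem _)
  insert_one_mem h := S.semidirect_insert_one h
  nabla_one_left {a} ha := by
    refine Prod.ext (F.nabla_one_left _) ?_
    change H.nabla [S.actOne H.one [a.1], S.actOne a.2 []] = a.2
    have e := S.act_fix_one (F.singleton_mem a.1)
    rw [S.act_singleton (S.dom_one (F.singleton_mem a.1))] at e
    rw [S.actOne_nil, show S.actOne H.one [a.1] = H.one by simpa using e, H.nabla_one_left]
  nabla_one_right {a} ha := by
    refine Prod.ext (F.nabla_one_right _) ?_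
    change H.nabla [S.actOne a.2 [F.one], S.actOne H.one []] = a.2
    have hd : S.dom [a.2] ([] ++ [F.one] ++ []) :=
      S.dom_insert_one (S.dom_nil (H.singleton_mem _))
    have e := S.act_one (H.singleton_mem a.2)
    rw [S.act_singleton (γ := [F.one]) hd] at e
    rw [S.actOne_nil, show S.actOne a.2 [F.one] = a.2 by simpa using e, H.nabla_one_right]
  mul_inv_mem h := S.append_inverse h
  inv_mul_mem {w} h := by
    have h1 := S.append_inverse h
    have h2 := S.semidirect_right h1 (by simpa using h.1)
    have h3 := S.append_inverse h2
    have e : (((w.map S.semidirectInv).reverse).map S.semidirectInv).reverse = w := by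
      rw [List.map_reverse, List.reverse_reverse, List.map_map]
      conv_rhs => rw [← List.map_id w]
      refine List.map_congr_left fun a ha => ?_
      obtain ⟨s, t, rfl⟩ := List.append_of_mem ha
      have k1 := S.semidirect_right h (by simp)
      exact S.semidirectInv_semidirectInv (S.semidirect_left (p := [a]) k1 (by simp)).1
    rwa [e] at h3
  nabla_mul_inv {a} h := by
    refine Prod.ext (F.nabla_mul_inv _) ?_
    change H.nabla [S.actOne a.2 [F.inv a.1], S.actOne (H.inv (S.actOne a.2 [F.inv a.1])) []]
      = H.one
    rw [S.actOne_nil, H.nabla_mul_inv]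
  nabla_inv_mul {a} h := by
    refine Prod.ext (F.nabla_inv_mul _) ?_
    change H.nabla [S.actOne (H.inv (S.actOne a.2 [F.inv a.1])) [a.1], S.actOne a.2 []] = H.one
    rw [semidirect_singleton] at h
    have h0 := S.act_back h
    have h1 : S.dom [S.actOne a.2 [F.inv a.1]] [a.1] := by
      have := h0.1
      rw [S.act_singleton h] at this
      simpa [PartialGroup.invWord, F.inv_inv] using this
    have h2 := S.actOne_back h
    rw [show F.invWord [F.inv a.1] = [a.1] by simp [PartialGroup.invWord, F.inv_inv]] at h2
    rw [(S.actOne_inv h1).2, h2, S.actOne_nil, H.nabla_inv_mul]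

/-- The semidirect product `F ⋉ H` of an `F`-partial group `H` by `F`. -/
noncomputable def semidirect {F H : PartialGroup.{u}} (S : PartialGroupAction F H) :
    PartialGroup.{u} :=
  S.semidirectSystem.toPartialGroup

end PartialGroupAction

/-- Let `jp : G₊ → K`, `jm : G₋ → K` be maps from subgroups of a group to a partial group `K`.
Write `G(1) = G₊` and `G(0) = G₋`.  `Represents jp jm i η a` says that `a` is a word in `G(i)` and
`η` is its image in `K`. -/
inductive Represents {G₀ : Type} [Group G₀] {Gp Gm : Subgroup G₀} {K : PartialGroup.{0}}
    (jp : PartialGroup.ofGroup Gp ⟶ K) (jm : PartialGroup.ofGroup Gm ⟶ K) :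
    ℤ → List K → List G₀ → Prop
  | plus (a : List Gp) : Represents jp jm 1 (a.map jp.fn) (a.map Subtype.val)
  | minus (a : List Gm) : Represents jp jm 0 (a.map jm.fn) (a.map Subtype.val)

/-- The action `S` of `𝒱({0, 1})` on `K` is the one by conjugation with `γ`:
`K_r 𝒱({0,1})ₙ` consists of the `(a | ι₁ - ι₀, …, ιₙ - ιₙ₋₁)` with `ι₀, …, ιₙ ∈ {0, 1}` and
`a` (the image of) a word of length `r` in `G(ι₀)`, and `◁` sends such an element to (the image of)
the word `(γ^(ι₀ - ιₙ) aₖ γ^(ιₙ - ι₀))ₖ` in `G(ιₙ)`. -/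
structure IsConjugationAction {G₀ : Type} [Group G₀] {Gp Gm : Subgroup G₀} {K : PartialGroup.{0}}
    (jp : PartialGroup.ofGroup Gp ⟶ K) (jm : PartialGroup.ofGroup Gm ⟶ K) (γ : G₀)
    (S : PartialGroupAction V01 K) : Prop where
  dom_iff : ∀ (η : List K) (δ : List V01), δ ≠ [] →
    (S.dom η δ ↔ ∃ (i j : ℤ) (a : List G₀), a ≠ [] ∧
      IsRoute (· + ·) {0, 1} i (δ.map vectorParades.vec) j ∧ Represents jp jm i η a)
  act_eq : ∀ (η : List K) (δ : List V01) (i j : ℤ) (a : List G₀), δ ≠ [] → a ≠ [] →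
    IsRoute (· + ·) {0, 1} i (δ.map vectorParades.vec) j → Represents jp jm i η a →
      Represents jp jm j (S.act η δ) (a.map fun g => γ ^ (i - j) * g * γ ^ (j - i))

/-- The inclusion `G₊ ∩ G₋ → G₊`, as a map of partial groups. -/
def interToLeft {G₀ : Type} [Group G₀] (Gp Gm : Subgroup G₀) :
    PartialGroup.ofGroup (Gp ⊓ Gm : Subgroup G₀) ⟶ PartialGroup.ofGroup Gp :=
  PartialGroup.ofGroupHom (Subgroup.inclusion inf_le_left)

/-- The inclusion `G₊ ∩ G₋ → G₋`, as a map of partial groups. -/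
def interToRight {G₀ : Type} [Group G₀] (Gp Gm : Subgroup G₀) :
    PartialGroup.ofGroup (Gp ⊓ Gm : Subgroup G₀) ⟶ PartialGroup.ofGroup Gm :=
  PartialGroup.ofGroupHom (Subgroup.inclusion inf_le_right)

/-! Everything takes place inside the ambient group `G₀`, which is E(d) or M(d). Write F(1) = F₊,
F(0) = F₋, and G(1), G(0) for their symmetry groups.

The pushout is simply the union G(1) ∪ G(0) inside `G₀`, a word being a sequence whose letters all
lie in one of the two groups (`isPushout_union`). No free product appears: in a partial group,
elements of different groups need not have a product, so two maps that agree on the intersection can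
be glued elementwise. Since F₋γ = F₊, conjugation by powers of γ carries G(0) and G(1) into each
other, and this gives the action (`IsAmalgam.conjAction`).

The isomorphism is δ ⋉ η ↦ γ^δ η. A word (δₖ ⋉ ηₖ) of the semidirect product amounts to a path ι₀,
…, ιₙ in {0, 1} with steps δₖ such that ηₖ ∈ G(ιₖ) (`IsAmalgam.mem_semidirectDom_iff`). As γ^δₖ
carries F(ιₖ₋₁) to F(ιₖ), the condition on ηₖ says that γ^δₖ ηₖ does so too, so the word becomes a
parade through F(ι₀), …, F(ιₙ). Products correspond because collecting all powers of γ at the left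
of ∏ γ^δₖ ηₖ conjugates the ηₖ exactly as in A(α) (`IsAmalgam.prod_wordA`).

Conversely, an element g with F(i)g = F(j) factors as γ^(j-i) η with η ∈ G(j). For this to invert
the map, j - i must depend on g alone, and here the absence of an exchanging isometry enters
(`displacement_unique`): an element that carries both sets to sets of the pair either fixes both,
with displacement 0 each time, or exchanges them, with displacements 1 and -1, and the latter is
excluded. This yields injectivity, and also that elements of the semidirect product whose images
form a parade form a word themselves (`SemidirectRoute.of_isRoute`). -/

theorem List.map_map_of_comp_eq {A B C : Type*} {f : A → B} {g : B → C} {h : A → C}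
    (e : ∀ x, g (f x) = h x) (w : List A) : (w.map f).map g = w.map h := by
  rw [List.map_map]; exact List.map_congr_left fun x _ => e x

theorem List.map_map_of_leftInverse {A B : Type*} {f : A → B} {g : B → A}
    (e : ∀ x, g (f x) = x) (w : List A) : (w.map f).map g = w :=
  (List.map_map_of_comp_eq (h := id) e w).trans (List.map_id w)

/-! ### Morphisms of partial groups, and subgroups as partial groups -/

namespace PartialGroup

@[simp] theorem fn_comp {P Q R : PartialGroup.{u}} (f : P ⟶ Q) (g : Q ⟶ R) (x : P) :
    (f ≫ g).fn x = g.fn (f.fn x) := rfl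

theorem hom_ext {P Q : PartialGroup.{u}} {f g : P ⟶ Q} (h : ∀ x, f.fn x = g.fn x) : f = g :=
  Hom.ext (funext h)

theorem fn_mem {P Q : PartialGroup.{u}} (f : P ⟶ Q) {w : List P} (h : w ∈ P.dom) :
    w.map f.fn ∈ Q.dom := Hom.map_mem f h

theorem fn_nabla {P Q : PartialGroup.{u}} (f : P ⟶ Q) {w : List P} (h : w ∈ P.dom) :
    Q.nabla (w.map f.fn) = f.fn (P.nabla w) := Hom.map_nabla f h

theorem hom_inv_fn {P Q : PartialGroup.{u}} (e : P ≅ Q) (x : P) : e.inv.fn (e.hom.fn x) = x := by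
  rw [← fn_comp, e.hom_inv_id]; rfl

theorem iso_mem_iff {P Q : PartialGroup.{u}} (e : P ≅ Q) {w : List P} :
    w.map e.hom.fn ∈ Q.dom ↔ w ∈ P.dom := by
  refine ⟨fun h => ?_, fn_mem e.hom⟩
  have := fn_mem e.inv h
  rwa [List.map_map_of_leftInverse (hom_inv_fn e)] at this

/-- A bijective map of partial groups that reflects words is an isomorphism. -/
noncomputable def isoOfBijective {P Q : PartialGroup.{u}} (f : P ⟶ Q)
    (hf : Function.Bijective f.fn) (h : ∀ w : List P, w.map f.fn ∈ Q.dom → w ∈ P.dom) : P ≅ Q :=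
  let g := (Equiv.ofBijective f.fn hf).symm
  have hg : ∀ y, f.fn (g y) = y := (Equiv.ofBijective f.fn hf).apply_symm_apply
  have hm : ∀ w : List Q, (w.map g).map f.fn = w := List.map_map_of_leftInverse hg
  have hd : ∀ {w}, w ∈ Q.dom → w.map g ∈ P.dom := fun {w} hw => h _ (by rwa [hm])
  { hom := f
    -- Compatibility of the inverse with products is tested after applying the injective `f`.
    inv := Hom.mk (P := Q) (Q := P) g hd (fun {w} hw => hf.1 (by
      rw [← fn_nabla f (hd hw), hm, hg]))
    hom_inv_id := hom_ext fun x => hf.1 (hg _)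
    inv_hom_id := hom_ext hg }

/-- The element of `G₀` underlying an element of a subgroup. -/
def elt {G₀ : Type u} [Group G₀] {G : Subgroup G₀} (x : ofGroup G) : G₀ := Subtype.val x

/-- An element of a subgroup, as an element of the corresponding partial group. -/
def ofMem {G₀ : Type u} [Group G₀] {G : Subgroup G₀} (x : G₀) (h : x ∈ G) : ofGroup G :=
  (⟨x, h⟩ : G)

theorem elt_mem {G₀ : Type u} [Group G₀] {G : Subgroup G₀} (x : ofGroup G) : elt x ∈ G :=
  Subtype.property (show G from x)

theorem exists_map_elt {G₀ : Type u} [Group G₀] {G : Subgroup G₀} {w : List G₀}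
    (h : ∀ x ∈ w, x ∈ G) : ∃ a : List (ofGroup G), a.map elt = w := by
  induction w with
  | nil => exact ⟨[], rfl⟩
  | cons x w ih =>
    obtain ⟨a, rfl⟩ := ih fun y hy => h y (List.mem_cons_of_mem _ hy)
    exact ⟨ofMem x (h x List.mem_cons_self) :: a, rfl⟩

theorem ofGroup_mem {G : Type u} [Group G] {w : List (ofGroup G)} :
    w ∈ (ofGroup G).dom ↔ w ≠ [] := Iff.rfl

end PartialGroup

/-! ### Maps into partial groups of words -/

namespace WordSystem

theorem map_val_mem {T : Type u} {D : WordSystem T} {w : List D.toPartialGroup} :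
    w ∈ D.toPartialGroup.dom ↔ w.map val ∈ D.dom := Iff.rfl

theorem val_nabla {T : Type u} {D : WordSystem T} {w : List D.toPartialGroup}
    (h : w ∈ D.toPartialGroup.dom) : val (D.toPartialGroup.nabla w) = D.nabla (w.map val) :=
  congrArg Subtype.val (dif_pos (map_val_mem.1 h))

theorem val_injective {T : Type u} {D : WordSystem T} :
    Function.Injective (val : D.toPartialGroup → T) := Subtype.val_injective

/-- A map into a partial group of words, given by a map into the ambient type. -/
noncomputable def lift {T : Type u} {D : WordSystem T} {P : PartialGroup.{u}} (f : P → T)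
    (hf : ∀ {w}, w ∈ P.dom → w.map f ∈ D.dom)
    (hn : ∀ {w}, w ∈ P.dom → D.nabla (w.map f) = f (P.nabla w)) : P ⟶ D.toPartialGroup :=
  let g : P → D.toPartialGroup := fun x => ⟨f x, hf (P.singleton_mem x)⟩
  have hg : ∀ w : List P, (w.map g).map val = w.map f := fun w => by
    rw [List.map_map]; rfl
  have hd : ∀ {w}, w ∈ P.dom → w.map g ∈ D.toPartialGroup.dom := fun {w} hw => by
    rw [map_val_mem, hg]; exact hf hw
  PartialGroup.Hom.mk (P := P) (Q := D.toPartialGroup) g hd (fun {w} hw =>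
    val_injective (by rw [val_nabla (hd hw), hg, hn hw]; rfl))

end WordSystem

/-! ### The pushout of two subgroups over their intersection -/

section Amalgam

variable {G₀ : Type} [Group G₀] (Gp Gm : Subgroup G₀)

/-- The words in `G₀` whose letters lie all in `G₊` or all in `G₋`. -/
def unionSystem : WordSystem G₀ where
  dom := {w | w ≠ [] ∧ ((∀ x ∈ w, x ∈ Gp) ∨ (∀ x ∈ w, x ∈ Gm))}
  nabla := List.prod
  one := 1
  inv x := x⁻¹
  ne_nil h := h.1
  nabla_singleton _ := by simp
  tail_mem := by
    rintro x w ⟨-, h⟩ hw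
    exact ⟨hw, h.imp (fun h y hy => h y (by simp [hy])) (fun h y hy => h y (by simp [hy]))⟩
  init_mem := by
    rintro w x ⟨-, h⟩ hw
    exact ⟨hw, h.imp (fun h y hy => h y (by simp [hy])) (fun h y hy => h y (by simp [hy]))⟩
  contract_mem := by
    rintro p q r ⟨-, h⟩ hq
    -- Closure is a matter of a single subgroup containing all letters, so one argument serves both
    -- alternatives.
    have key : ∀ G : Subgroup G₀, (∀ x ∈ p ++ q ++ r, x ∈ G) → ∀ x ∈ p ++ [q.prod] ++ r, x ∈ G := by
      intro G h x hx
      simp only [List.append_assoc, List.mem_append, List.mem_singleton] at h hx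
      rcases hx with hx | rfl | hx
      · exact h _ (Or.inl hx)
      · exact list_prod_mem fun y hy => h y (Or.inr (Or.inl hy))
      · exact h _ (Or.inr (Or.inr hx))
    exact ⟨by simp, h.imp (key _) (key _)⟩
  nabla_contract _ _ := by simp
  one_mem := by simp
  insert_one_mem := by
    rintro p q ⟨-, h⟩
    have key : ∀ G : Subgroup G₀, (∀ x ∈ p ++ q, x ∈ G) → ∀ x ∈ p ++ [1] ++ q, x ∈ G := by
      intro G h x hx
      simp only [List.append_assoc, List.mem_append, List.mem_singleton] at h hx
      rcases hx with hx | rfl | hx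
      · exact h _ (Or.inl hx)
      · exact one_mem G
      · exact h _ (Or.inr hx)
    exact ⟨by simp, h.imp (key _) (key _)⟩
  nabla_one_left _ := by simp
  nabla_one_right _ := by simp
  mul_inv_mem := by
    rintro w ⟨hw, h⟩
    have key : ∀ G : Subgroup G₀, (∀ x ∈ w, x ∈ G) → ∀ x ∈ w ++ (w.map fun x => x⁻¹).reverse, x ∈ G := by
      intro G h x hx
      simp only [List.mem_append, List.mem_reverse, List.mem_map] at hx
      rcases hx with hx | ⟨y, hy, rfl⟩
      · exact h _ hx
      · exact inv_mem (h _ hy)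
    exact ⟨by simp [hw], h.imp (key _) (key _)⟩
  inv_mul_mem := by
    rintro w ⟨hw, h⟩
    have key : ∀ G : Subgroup G₀, (∀ x ∈ w, x ∈ G) → ∀ x ∈ (w.map fun x => x⁻¹).reverse ++ w, x ∈ G := by
      intro G h x hx
      simp only [List.mem_append, List.mem_reverse, List.mem_map] at hx
      rcases hx with ⟨y, hy, rfl⟩ | hx
      · exact inv_mem (h _ hy)
      · exact h _ hx
    exact ⟨by simp [hw], h.imp (key _) (key _)⟩
  nabla_mul_inv _ := by simp
  nabla_inv_mul _ := by simp

/-- The inclusion of `G₊` into the union of `G₊` and `G₋`. -/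
noncomputable def leftToUnion : PartialGroup.ofGroup Gp ⟶ (unionSystem Gp Gm).toPartialGroup :=
  WordSystem.lift (P := PartialGroup.ofGroup Gp) PartialGroup.elt
    (fun {w} h => ⟨by simpa using PartialGroup.ne_nil _ h, Or.inl fun x hx => by
      obtain ⟨y, -, rfl⟩ := List.mem_map.1 hx; exact PartialGroup.elt_mem y⟩)
    (fun {w} _ => (map_list_prod (M := Gp) Gp.subtype w).symm)

/-- The inclusion of `G₋` into the union of `G₊` and `G₋`. -/
noncomputable def rightToUnion : PartialGroup.ofGroup Gm ⟶ (unionSystem Gp Gm).toPartialGroup :=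
  WordSystem.lift (P := PartialGroup.ofGroup Gm) PartialGroup.elt
    (fun {w} h => ⟨by simpa using PartialGroup.ne_nil _ h, Or.inr fun x hx => by
      obtain ⟨y, -, rfl⟩ := List.mem_map.1 hx; exact PartialGroup.elt_mem y⟩)
    (fun {w} _ => (map_list_prod (M := Gm) Gm.subtype w).symm)

/-- Reduces questions on words of the union with letters in `G₊` to words of the group `G₊` itself,
where a given map out of `G₊` already respects products. -/
theorem exists_map_leftToUnion (w : List (unionSystem Gp Gm).toPartialGroup)
    (h : ∀ x ∈ w.map WordSystem.val, x ∈ Gp) :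
    ∃ a : List (PartialGroup.ofGroup Gp), a.map (leftToUnion Gp Gm).fn = w := by
  obtain ⟨a, ha⟩ := PartialGroup.exists_map_elt h
  refine ⟨a, WordSystem.val_injective.list_map ?_⟩
  rw [← ha]
  exact List.map_map_of_comp_eq (fun _ => rfl) a

theorem exists_map_rightToUnion (w : List (unionSystem Gp Gm).toPartialGroup)
    (h : ∀ x ∈ w.map WordSystem.val, x ∈ Gm) :
    ∃ a : List (PartialGroup.ofGroup Gm), a.map (rightToUnion Gp Gm).fn = w := by
  obtain ⟨a, ha⟩ := PartialGroup.exists_map_elt h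
  refine ⟨a, WordSystem.val_injective.list_map ?_⟩
  rw [← ha]
  exact List.map_map_of_comp_eq (fun _ => rfl) a

variable {Gp Gm} in
open Classical in
/-- The map on the union of `G₊` and `G₋` that restricts to given maps on `G₊` and `G₋`. -/
noncomputable def unionDescFun {Q : PartialGroup.{0}} (f : PartialGroup.ofGroup Gp ⟶ Q)
    (g : PartialGroup.ofGroup Gm ⟶ Q) (x : (unionSystem Gp Gm).toPartialGroup) : Q :=
  if h : WordSystem.val x ∈ Gp then f.fn (PartialGroup.ofMem (WordSystem.val x) h) else
    if h : WordSystem.val x ∈ Gm then g.fn (PartialGroup.ofMem (WordSystem.val x) h) else Q.one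

variable {Gp Gm} in
theorem unionDescFun_left {Q : PartialGroup.{0}} (f : PartialGroup.ofGroup Gp ⟶ Q)
    (g : PartialGroup.ofGroup Gm ⟶ Q) (x : PartialGroup.ofGroup Gp) :
    unionDescFun f g ((leftToUnion Gp Gm).fn x) = f.fn x :=
  dif_pos (PartialGroup.elt_mem x)

variable {Gp Gm} in
-- On G₊ ∩ G₋ the glued function takes the value of `f`, so it is here that the agreement of `f` and
-- `g` on the intersection is needed.
theorem unionDescFun_right {Q : PartialGroup.{0}} (f : PartialGroup.ofGroup Gp ⟶ Q)
    (g : PartialGroup.ofGroup Gm ⟶ Q) (hfg : interToLeft Gp Gm ≫ f = interToRight Gp Gm ≫ g)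
    (x : PartialGroup.ofGroup Gm) :
    unionDescFun f g ((rightToUnion Gp Gm).fn x) = g.fn x := by
  by_cases h : PartialGroup.elt x ∈ Gp
  · have := congrArg (fun k => PartialGroup.Hom.fn k 
      (PartialGroup.ofMem (PartialGroup.elt x) (Subgroup.mem_inf.2 ⟨h, PartialGroup.elt_mem x⟩))) hfg
    exact (dif_pos h).trans this
  · exact (dif_neg h).trans (dif_pos (PartialGroup.elt_mem x))

/-- The pushout of `G₊ ← G₊ ∩ G₋ → G₋` is the union of `G₊` and `G₋`. -/
theorem isPushout_union : IsPushout (interToLeft Gp Gm) (interToRight Gp Gm)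
    (leftToUnion Gp Gm) (rightToUnion Gp Gm) := by
  refine ⟨⟨rfl⟩, ⟨Limits.PushoutCocone.IsColimit.mk _
    (fun s => PartialGroup.Hom.mk (P := (unionSystem Gp Gm).toPartialGroup) (Q := s.pt)
      (unionDescFun s.inl s.inr) ?_ ?_) ?_ ?_ ?_⟩⟩
  -- A word of the union is already a word of one of the two groups, so words, and below their
  -- products, are respected because the corresponding leg of the cocone respects them.
  · rintro w ⟨h0, h | h⟩
    · obtain ⟨a, rfl⟩ := exists_map_leftToUnion Gp Gm w h
      rw [List.map_map_of_comp_eq (unionDescFun_left s.inl s.inr)]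
      exact PartialGroup.fn_mem _ (PartialGroup.ofGroup_mem.2 (by rintro rfl; exact h0 rfl))
    · obtain ⟨a, rfl⟩ := exists_map_rightToUnion Gp Gm w h
      rw [List.map_map_of_comp_eq (unionDescFun_right _ _ s.condition)]
      exact PartialGroup.fn_mem _ (PartialGroup.ofGroup_mem.2 (by rintro rfl; exact h0 rfl))
  · rintro w ⟨h0, h | h⟩
    · obtain ⟨a, rfl⟩ := exists_map_leftToUnion Gp Gm w h
      have ha : a ∈ (PartialGroup.ofGroup Gp).dom :=
        PartialGroup.ofGroup_mem.2 (by rintro rfl; exact h0 rfl)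
      rw [List.map_map_of_comp_eq (unionDescFun_left s.inl s.inr),
        PartialGroup.fn_nabla _ ha, PartialGroup.fn_nabla _ ha, unionDescFun_left]
    · obtain ⟨a, rfl⟩ := exists_map_rightToUnion Gp Gm w h
      have ha : a ∈ (PartialGroup.ofGroup Gm).dom :=
        PartialGroup.ofGroup_mem.2 (by rintro rfl; exact h0 rfl)
      rw [List.map_map_of_comp_eq (unionDescFun_right _ _ s.condition),
        PartialGroup.fn_nabla _ ha, PartialGroup.fn_nabla _ ha,
        unionDescFun_right _ _ s.condition]
  · intro s
    exact PartialGroup.hom_ext fun x => unionDescFun_left _ _ x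
  · intro s
    exact PartialGroup.hom_ext fun x => unionDescFun_right _ _ s.condition x
  · intro s m h1 h2
    refine PartialGroup.hom_ext fun x => ?_
    change m.fn x = unionDescFun s.inl s.inr x
    -- Uniqueness: membership of a one-letter word puts its letter into one of the two groups, where
    -- `m` is prescribed.
    have hx : WordSystem.val x ∈ Gp ∨ WordSystem.val x ∈ Gm := 
      (Subtype.property (p := fun t => [t] ∈ (unionSystem Gp Gm).dom) x).2.imp
        (fun h => h _ List.mem_cons_self) (fun h => h _ List.mem_cons_self)
    rcases hx with hx | hx
    · have e : x = (leftToUnion Gp Gm).fn (PartialGroup.ofMem (WordSystem.val x) hx) := rfl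
      rw [e, unionDescFun_left, ← h1]; rfl
    · have e : x = (rightToUnion Gp Gm).fn (PartialGroup.ofMem (WordSystem.val x) hx) := rfl
      rw [e, unionDescFun_right _ _ s.condition, ← h2]; rfl

variable {Gp Gm}

/-- `val` identifies `K` with the union of `G₊` and `G₋` inside `G₀`, the words of `K` being those
with all letters in `G₊` or all letters in `G₋`. -/
structure IsAmalgam {K : PartialGroup.{0}} (jp : PartialGroup.ofGroup Gp ⟶ K)
    (jm : PartialGroup.ofGroup Gm ⟶ K) (val : K → G₀) : Prop where
  injective : Function.Injective val
  val_left : ∀ x, val (jp.fn x) = PartialGroup.elt x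
  val_right : ∀ x, val (jm.fn x) = PartialGroup.elt x
  dom_iff : ∀ {w}, w ∈ K.dom ↔ w ≠ [] ∧ ((∀ x ∈ w, val x ∈ Gp) ∨ ∀ x ∈ w, val x ∈ Gm)
  val_nabla : ∀ {w}, w ∈ K.dom → val (K.nabla w) = (w.map val).prod

/-- Any pushout is isomorphic to the union, compatibly with both legs; `val` is this isomorphism
followed by the inclusion into `G₀`. An arbitrary pushout `K` can then be handled through `val`
alone, identities in `K` being checked in the group `G₀`. -/
theorem exists_isAmalgam {K : PartialGroup.{0}} {jp : PartialGroup.ofGroup Gp ⟶ K}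
    {jm : PartialGroup.ofGroup Gm ⟶ K}
    (h : IsPushout (interToLeft Gp Gm) (interToRight Gp Gm) jp jm) :
    ∃ val : K → G₀, IsAmalgam jp jm val := by
  let e := IsPushout.isoIsPushout _ _ h (isPushout_union Gp Gm)
  refine ⟨fun x => WordSystem.val (e.hom.fn x), ?_, ?_, ?_, ?_, ?_⟩
  · exact fun x y hxy => by
      rw [← PartialGroup.hom_inv_fn e x, WordSystem.val_injective hxy, PartialGroup.hom_inv_fn]
  · intro x
    rw [← PartialGroup.fn_comp, IsPushout.inl_isoIsPushout_hom]; rfl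
  · intro x
    rw [← PartialGroup.fn_comp, IsPushout.inr_isoIsPushout_hom]; rfl
  · intro w
    rw [← PartialGroup.iso_mem_iff e, WordSystem.map_val_mem]
    simp [unionSystem]
  · intro w hw
    rw [← PartialGroup.fn_nabla e.hom hw, WordSystem.val_nabla (PartialGroup.fn_mem e.hom hw),
      List.map_map]
    rfl

end Amalgam

/-! ### Words of `𝒱({0, 1})` as paths in {0, 1} -/

namespace V01

/-- The integer underlying an element of `𝒱({0, 1})`. -/
noncomputable abbrev vec : V01 → ℤ := vectorParades.vec

/-- `Route i δ j`: the word `δ` leads from `i` to `j` inside `{0, 1}`. -/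
abbrev Route (i : ℤ) (δ : List V01) (j : ℤ) : Prop :=
  IsRoute (· + ·) ({0, 1} : Set ℤ) i (δ.map vec) j

theorem mem_dom_iff {δ : List V01} : δ ∈ V01.dom ↔ δ ≠ [] ∧ ∃ i j, Route i δ j := by
  refine Iff.trans (b := δ.map vec ≠ [] ∧ ∃ i j, Route i δ j) Iff.rfl ?_
  rw [ne_eq, List.map_eq_nil_iff]

theorem vec_injective : Function.Injective vec := WordSystem.val_injective

theorem vec_nabla {δ : List V01} (h : δ ∈ V01.dom) : vec (V01.nabla δ) = (δ.map vec).sum :=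
  WordSystem.val_nabla h

theorem vec_one : vec V01.one = 0 := rfl

theorem vec_inv (x : V01) : vec (V01.inv x) = -vec x := rfl

theorem exists_vec {i j : ℤ} (hi : i ∈ ({0, 1} : Set ℤ)) (hj : j ∈ ({0, 1} : Set ℤ)) :
    ∃ x : V01, vec x = j - i := by
  refine ⟨(⟨j - i, by simp, i, j, hi, ?_⟩ : {t : ℤ // [t] ∈ (vectorSystem {0, 1} _).dom}), rfl⟩
  exact ⟨by simpa using hj, by simp⟩

namespace Route

/-- The displacement along a route is determined by the word. Routes themselves are not unique, a
word of zeros having two of them, so conjugation is indexed by the sum of the letters instead of by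
a chosen route. -/
theorem eq_add {i j : ℤ} {δ : List V01} (h : Route i δ j) : j = i + (δ.map vec).sum := by
  rw [← IsRoute.foldl_eq h]
  generalize δ.map vec = w
  induction w generalizing i with
  | nil => simp
  | cons a w ih =>
    rw [List.foldl_cons, List.sum_cons, ← add_assoc]
    generalize i + a = k
    -- What remains is an identity about folding that holds for every starting point, so a fresh
    -- induction without a route replaces `ih`.
    clear ih h
    induction w generalizing k with
    | nil => simp
    | cons b w ih => rw [List.foldl_cons, ih, List.sum_cons, add_assoc]

theorem append_iff {i j : ℤ} {δ ε : List V01} :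
    Route i (δ ++ ε) j ↔ ∃ k, Route i δ k ∧ Route k ε j := by
  rw [Route, List.map_append, IsRoute.append_iff]

theorem nil {i : ℤ} (h : i ∈ ({0, 1} : Set ℤ)) : Route i [] i := ⟨h, rfl⟩

theorem singleton {i j : ℤ} {x : V01} (hi : i ∈ ({0, 1} : Set ℤ)) (hj : j ∈ ({0, 1} : Set ℤ))
    (h : i + vec x = j) : Route i [x] j := by
  subst h; exact ⟨hi, hj, rfl⟩

theorem mem_dom {i j : ℤ} {δ : List V01} (h : Route i δ j) (hδ : δ ≠ []) : δ ∈ V01.dom :=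
  mem_dom_iff.2 ⟨hδ, i, j, h⟩

theorem contract {i j : ℤ} {p q r : List V01} (h : Route i (p ++ q ++ r) j) (hq : q ≠ []) :
    Route i (p ++ [V01.nabla q] ++ r) j := by
  obtain ⟨k, h1, h3⟩ := append_iff.1 h
  obtain ⟨l, h1, h2⟩ := append_iff.1 h1
  exact append_iff.2 ⟨k, append_iff.2 ⟨l, h1, singleton h1.right_mem h3.left_mem (by
    rw [vec_nabla (h2.mem_dom hq), h2.eq_add])⟩, h3⟩

theorem insert_one {i j : ℤ} {p r : List V01} (h : Route i (p ++ r) j) :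
    Route i (p ++ [V01.one] ++ r) j := by
  obtain ⟨k, h1, h3⟩ := append_iff.1 h
  exact append_iff.2 ⟨k, append_iff.2 ⟨k, h1, singleton h1.right_mem h3.left_mem (by
    rw [vec_one, add_zero])⟩, h3⟩

theorem invWord {i j : ℤ} {δ : List V01} (h : Route i δ j) : Route j (V01.invWord δ) i := by
  induction δ generalizing i with
  | nil => exact ⟨IsRoute.right_mem h, h.2.symm⟩
  | cons x δ ih =>
    rw [PartialGroup.invWord_cons]
    refine append_iff.2 ⟨i + vec x, ih h.2, singleton (IsRoute.left_mem h.2) h.1 ?_⟩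
    rw [vec_inv]; ring

end Route

end V01

/-! ### The conjugation action on the pushout -/

open V01 (vec Route)

/-- The groups `G(1) = G₊` and `G(0) = G₋`. -/
def groupAt {G₀ : Type} [Group G₀] (Gp Gm : Subgroup G₀) (i : ℤ) : Subgroup G₀ :=
  if i = 1 then Gp else Gm

section

variable {G₀ : Type} [Group G₀] {Gp Gm : Subgroup G₀}

/-- Conjugation with the powers of `γ` interchanges the groups `G(i)`. -/
def ConjugatesGroups (Gp Gm : Subgroup G₀) (γ : G₀) : Prop :=
  ∀ i ∈ ({0, 1} : Set ℤ), ∀ j ∈ ({0, 1} : Set ℤ), ∀ g ∈ groupAt Gp Gm i,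
    γ ^ (i - j) * g * γ ^ (j - i) ∈ groupAt Gp Gm j

variable {K : PartialGroup.{0}} {jp : PartialGroup.ofGroup Gp ⟶ K}
  {jm : PartialGroup.ofGroup Gm ⟶ K} {val : K → G₀}

namespace IsAmalgam

theorem mem_dom_iff (h : IsAmalgam jp jm val) {w : List K} :
    w ∈ K.dom ↔ w ≠ [] ∧ ∃ i ∈ ({0, 1} : Set ℤ), ∀ x ∈ w, val x ∈ groupAt Gp Gm i := by
  rw [h.dom_iff]
  simp [groupAt, or_comm]

theorem exists_val (h : IsAmalgam jp jm val) {i : ℤ} {g : G₀} (hg : g ∈ groupAt Gp Gm i) :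
    ∃ x, val x = g := by
  unfold groupAt at hg
  split_ifs at hg
  · exact ⟨jp.fn (PartialGroup.ofMem g hg), h.val_left _⟩
  · exact ⟨jm.fn (PartialGroup.ofMem g hg), h.val_right _⟩

/-- In `K` one has 1 · 1 = 1, so the image of the unit is an idempotent of a group. -/
theorem val_one (h : IsAmalgam jp jm val) : val K.one = 1 := by
  have h1 : [K.one, K.one] ∈ K.dom := K.insert_one_mem (p := []) (K.singleton_mem K.one)
  have h2 := h.val_nabla h1
  rw [K.nabla_one_left] at h2
  simpa using h2

theorem val_inv (h : IsAmalgam jp jm val) (x : K) : val (K.inv x) = (val x)⁻¹ := by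
  have h1 : [x, K.inv x] ∈ K.dom := K.mul_inv_mem (K.singleton_mem x)
  have h2 := h.val_nabla h1
  rw [K.nabla_mul_inv, h.val_one] at h2
  exact eq_inv_of_mul_eq_one_right (by simpa using h2.symm)

/-- Since `val` is injective, a word of `K` is recovered from its letters in `G₀`. This turns the
specification of the action by representing words into plain membership conditions. -/
theorem represents_iff (h : IsAmalgam jp jm val) {i : ℤ} {η : List K} {a : List G₀} :
    Represents jp jm i η a ↔
      i ∈ ({0, 1} : Set ℤ) ∧ (∀ x ∈ η, val x ∈ groupAt Gp Gm i) ∧ a = η.map val := by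
  constructor
  · rintro (a | a)
    · refine ⟨by simp, fun x hx => ?_, (List.map_map_of_comp_eq h.val_left a).symm⟩
      obtain ⟨y, -, rfl⟩ := List.mem_map.1 hx
      rw [h.val_left]
      exact PartialGroup.elt_mem y
    · refine ⟨by simp, fun x hx => ?_, (List.map_map_of_comp_eq h.val_right a).symm⟩
      obtain ⟨y, -, rfl⟩ := List.mem_map.1 hx
      rw [h.val_right]
      exact PartialGroup.elt_mem y
  · rintro ⟨rfl | rfl, h1, rfl⟩
    · obtain ⟨a, ha⟩ := PartialGroup.exists_map_elt (G := Gm) (w := η.map val) (fun x hx => by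
        obtain ⟨y, hy, rfl⟩ := List.mem_map.1 hx; exact h1 y hy)
      have e : a.map jm.fn = η := h.injective.list_map (by
        rw [List.map_map_of_comp_eq h.val_right, ha])
      rw [← e, List.map_map_of_comp_eq h.val_right]
      exact Represents.minus a
    · obtain ⟨a, ha⟩ := PartialGroup.exists_map_elt (G := Gp) (w := η.map val) (fun x hx => by
        obtain ⟨y, hy, rfl⟩ := List.mem_map.1 hx; exact h1 y hy)
      have e : a.map jp.fn = η := h.injective.list_map (by
        rw [List.map_map_of_comp_eq h.val_left, ha])
      rw [← e, List.map_map_of_comp_eq h.val_left]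
      exact Represents.plus a

end IsAmalgam

open Classical in
/-- The element `γ⁻ⁿ x γⁿ` of `K`, where it exists. -/
noncomputable def conjBy (val : K → G₀) (γ : G₀) (n : ℤ) (x : K) : K :=
  if h : ∃ y, val y = γ ^ (-n) * val x * γ ^ n then h.choose else x

namespace IsAmalgam

variable {γ : G₀}

/-- The default value of `conjBy` does not occur here: along a route from `i` to `j` the conjugate
lies in G(j), hence in the image of `val`. -/
theorem val_conjBy (h : IsAmalgam jp jm val) (hγ : ConjugatesGroups Gp Gm γ) {i j : ℤ}
    {δ : List V01} (hδ : Route i δ j) {x : K} (hx : val x ∈ groupAt Gp Gm i) :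
    val (conjBy val γ (δ.map vec).sum x) =
      γ ^ (-(δ.map vec).sum) * val x * γ ^ (δ.map vec).sum := by
  have e := hδ.eq_add
  have := hγ i (IsRoute.left_mem hδ) j (IsRoute.right_mem hδ) _ hx
  rw [e] at this
  obtain ⟨y, hy⟩ := h.exists_val this
  have hex : ∃ y, val y = γ ^ (-(δ.map vec).sum) * val x * γ ^ (δ.map vec).sum :=
    ⟨y, by rw [hy]; congr <;> ring⟩
  rw [conjBy, dif_pos hex]
  exact hex.choose_spec

theorem conjBy_mem (h : IsAmalgam jp jm val) (hγ : ConjugatesGroups Gp Gm γ) {i j : ℤ}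
    {δ : List V01} (hδ : Route i δ j) {x : K} (hx : val x ∈ groupAt Gp Gm i) :
    val (conjBy val γ (δ.map vec).sum x) ∈ groupAt Gp Gm j := by
  have := hγ i (IsRoute.left_mem hδ) j (IsRoute.right_mem hδ) _ hx
  rw [h.val_conjBy hγ hδ hx]
  rw [hδ.eq_add] at this ⊢
  convert this using 3 <;> congr 1 <;> ring

theorem conjBy_zero (h : IsAmalgam jp jm val) (x : K) : conjBy val γ 0 x = x := by
  have hex : ∃ y, val y = γ ^ (-(0 : ℤ)) * val x * γ ^ (0 : ℤ) := ⟨x, by simp⟩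
  rw [conjBy, dif_pos hex]
  exact h.injective (hex.choose_spec.trans (by simp))

/-- No route is needed, since every conjugate of 1 is 1 and so always lies in the image of `val`. -/
theorem conjBy_one (h : IsAmalgam jp jm val) (n : ℤ) : conjBy val γ n K.one = K.one := by
  have hex : ∃ y, val y = γ ^ (-n) * val K.one * γ ^ n := ⟨K.one, by simp [h.val_one]⟩
  rw [conjBy, dif_pos hex]
  exact h.injective (hex.choose_spec.trans (by simp [h.val_one]))

theorem conjBy_inv (h : IsAmalgam jp jm val) (hγ : ConjugatesGroups Gp Gm γ) {i j : ℤ}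
    {δ : List V01} (hδ : Route i δ j) {x : K} (hx : val x ∈ groupAt Gp Gm i) :
    conjBy val γ (δ.map vec).sum (K.inv x) = K.inv (conjBy val γ (δ.map vec).sum x) := by
  have hx' : val (K.inv x) ∈ groupAt Gp Gm i := by rw [h.val_inv]; exact inv_mem hx
  apply h.injective
  rw [h.val_conjBy hγ hδ hx', h.val_inv, h.val_inv, h.val_conjBy hγ hδ hx]
  group

/-- If all letters lie in the same G(i), the conjugated letters lie in the same G(j) and can be
multiplied, and the inner powers of γ cancel. The closure of G(i) under products is recorded as well
because it keeps contracted words in the domain of the action. -/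
theorem conjBy_nabla (h : IsAmalgam jp jm val) (hγ : ConjugatesGroups Gp Gm γ) {i j : ℤ}
    {δ : List V01} (hδ : Route i δ j) {w : List K} (hw : w ≠ [])
    (hx : ∀ x ∈ w, val x ∈ groupAt Gp Gm i) :
    val (K.nabla w) ∈ groupAt Gp Gm i ∧
    conjBy val γ (δ.map vec).sum (K.nabla w) = K.nabla (w.map (conjBy val γ (δ.map vec).sum)) := by
  have hd : w ∈ K.dom := h.mem_dom_iff.2 ⟨hw, i, IsRoute.left_mem hδ, hx⟩
  have hd' : w.map (conjBy val γ (δ.map vec).sum) ∈ K.dom := by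
    refine h.mem_dom_iff.2 ⟨by simpa using hw, j, IsRoute.right_mem hδ, fun y hy => ?_⟩
    obtain ⟨x, hxw, rfl⟩ := List.mem_map.1 hy
    exact h.conjBy_mem hγ hδ (hx x hxw)
  have hm : val (K.nabla w) ∈ groupAt Gp Gm i := by
    rw [h.val_nabla hd]
    refine list_prod_mem fun y hy => ?_
    obtain ⟨x, hxw, rfl⟩ := List.mem_map.1 hy
    exact hx x hxw
  refine ⟨hm, h.injective ?_⟩
  rw [h.val_conjBy hγ hδ hm, h.val_nabla hd, h.val_nabla hd', List.map_map]
  -- The remaining identity in `G₀` also holds for the empty word, so the facts that depend on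
  -- nonemptiness are dropped before the induction.
  clear hw hd hd' hm
  induction w with
  | nil => simp
  | cons x w ih =>
    rw [List.map_cons, List.map_cons, List.prod_cons, List.prod_cons,
      ← ih (fun y hy => hx y (List.mem_cons_of_mem _ hy)), Function.comp_apply,
      h.val_conjBy hγ hδ (hx x List.mem_cons_self)]
    group

/-- `ConjDom val η δ`: the word `η` lies in some `G(i)` and `δ` leads from `i` to some `j`. -/
def _root_.ConjDom (Gp Gm : Subgroup G₀) (val : K → G₀) (η : List K) (δ : List V01) : Prop :=
  η ≠ [] ∧ ∃ i j, Route i δ j ∧ ∀ x ∈ η, val x ∈ groupAt Gp Gm i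

/-- The action of `𝒱({0, 1})` on an amalgam of `G₊` and `G₋` by conjugation. -/
noncomputable def conjAction (h : IsAmalgam jp jm val) (hγ : ConjugatesGroups Gp Gm γ) :
    PartialGroupAction V01 K where
  dom := ConjDom Gp Gm val
  act η δ := η.map (conjBy val γ (δ.map vec).sum)
  mem_of_dom := by
    rintro η δ ⟨h0, i, j, h1, h2⟩
    exact h.mem_dom_iff.2 ⟨h0, i, IsRoute.left_mem h1, h2⟩
  word_mem := by
    rintro η δ ⟨h0, i, j, h1, h2⟩ hδ
    exact h1.mem_dom hδ
  act_mem := by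
    rintro η δ ⟨h0, i, j, h1, h2⟩
    refine h.mem_dom_iff.2 ⟨by simpa using h0, j, IsRoute.right_mem h1, fun y hy => ?_⟩
    obtain ⟨x, hx, rfl⟩ := List.mem_map.1 hy
    exact h.conjBy_mem hγ h1 (h2 x hx)
  dom_nil := by
    intro η hη
    obtain ⟨h0, i, hi, h1⟩ := h.mem_dom_iff.1 hη
    exact ⟨h0, i, i, Route.nil hi, h1⟩
  act_nil := by
    intro η hη
    rw [List.map_congr_left (g := id) fun x _ => by simpa using h.conjBy_zero x, List.map_id]
  dom_init := by
    rintro η δ a ⟨h0, i, j, h1, h2⟩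
    obtain ⟨k, h1, -⟩ := Route.append_iff.1 h1
    exact ⟨h0, i, k, h1, h2⟩
  dom_act := by
    rintro η p q ⟨h0, i, j, h1, h2⟩
    obtain ⟨k, h1, h3⟩ := Route.append_iff.1 h1
    refine ⟨by simpa using h0, k, j, h3, fun y hy => ?_⟩
    obtain ⟨x, hx, rfl⟩ := List.mem_map.1 hy
    exact h.conjBy_mem hγ h1 (h2 x hx)
  act_act := by
    rintro η p q ⟨h0, i, j, h1, h2⟩
    obtain ⟨k, h3, h4⟩ := Route.append_iff.1 h1
    rw [List.map_map]
    -- In `G₀` both sides are conjugates of the same element by powers of γ, and the exponents add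
    -- up.
    refine List.map_congr_left fun x hx => h.injective ?_
    rw [h.val_conjBy hγ h1 (h2 x hx), Function.comp_apply,
      h.val_conjBy hγ h4 (h.conjBy_mem hγ h3 (h2 x hx)), h.val_conjBy hγ h3 (h2 x hx),
      List.map_append, List.sum_append]
    group
  dom_contract := by
    rintro η p q r ⟨h0, i, j, h1, h2⟩ hq
    exact ⟨h0, i, j, h1.contract hq, h2⟩
  act_contract := by
    rintro η p q r ⟨h0, i, j, h1, h2⟩ hq
    have e1 := h1.eq_add
    have e2 := (h1.contract hq).eq_add
    -- Both words lead from `i` to `j`, so their sums agree.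
    rw [show ((p ++ [V01.nabla q] ++ r).map vec).sum = ((p ++ q ++ r).map vec).sum by omega]
  dom_insert_one := by
    rintro η p q ⟨h0, i, j, h1, h2⟩
    exact ⟨h0, i, j, h1.insert_one, h2⟩
  act_one := by
    intro η hη
    rw [List.map_congr_left (g := id) fun x _ => by
      simpa [V01.vec_one] using h.conjBy_zero x, List.map_id]
  dom_mul_inv := by
    rintro η δ ⟨h0, i, j, h1, h2⟩
    exact ⟨h0, i, i, Route.append_iff.2 ⟨j, h1, h1.invWord⟩, h2⟩
  length_act _ := List.length_map _
  dom_tail := by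
    rintro η δ ⟨h0, i, j, h1, h2⟩ hl
    refine ⟨fun e => ?_, i, j, h1, fun x hx => h2 x (List.mem_of_mem_tail hx)⟩
    have := congrArg List.length e
    simp only [List.length_tail, List.length_nil] at this
    omega
  act_tail _ _ := List.map_tail
  dom_dropLast := by
    rintro η δ ⟨h0, i, j, h1, h2⟩ hl
    refine ⟨fun e => ?_, i, j, h1, fun x hx => h2 x (List.mem_of_mem_dropLast hx)⟩
    have := congrArg List.length e
    simp only [List.length_dropLast, List.length_nil] at this
    omega
  act_dropLast _ _ := List.map_dropLast
  dom_mul := by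
    rintro η δ m k ⟨h0, i, j, h1, h2⟩ hk hl
    refine ⟨by simp [PartialGroup.contract], i, j, h1, fun x hx => ?_⟩
    simp only [PartialGroup.contract, List.mem_append, List.mem_singleton] at hx
    rcases hx with (hx | rfl) | hx
    · exact h2 x (List.mem_of_mem_take hx)
    · refine (h.conjBy_nabla hγ h1 (fun e => ?_)
        fun y hy => h2 y (List.mem_of_mem_drop (List.mem_of_mem_take hy))).1
      have := congrArg List.length e
      simp only [List.length_take, List.length_drop, List.length_nil] at this
      omega
    · exact h2 x (List.mem_of_mem_drop hx)
  act_mul := by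
    rintro η δ m k ⟨h0, i, j, h1, h2⟩ hk hl
    simp only [PartialGroup.contract, List.map_append, List.map_cons, List.map_nil, List.map_take,
      List.map_drop]
    rw [(h.conjBy_nabla hγ h1 (fun e => ?_)
        fun y hy => h2 y (List.mem_of_mem_drop (List.mem_of_mem_take hy))).2, List.map_take,
      List.map_drop]
    have := congrArg List.length e
    simp only [List.length_take, List.length_drop, List.length_nil] at this
    omega
  dom_unit := by
    rintro η δ m ⟨h0, i, j, h1, h2⟩ hl
    refine ⟨by simp [PartialGroup.insertOne], i, j, h1, fun x hx => ?_⟩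
    simp only [PartialGroup.insertOne, List.mem_append, List.mem_singleton] at hx
    rcases hx with (hx | rfl) | hx
    · exact h2 x (List.mem_of_mem_take hx)
    · rw [h.val_one]; exact one_mem _
    · exact h2 x (List.mem_of_mem_drop hx)
  act_unit := by
    intro η δ m _ _
    simp only [PartialGroup.insertOne, List.map_append, List.map_cons, List.map_nil, List.map_take,
      List.map_drop, h.conjBy_one]
  dom_one := by
    intro δ hδ
    obtain ⟨-, i, j, h1⟩ := V01.mem_dom_iff.1 hδ
    exact ⟨by simp, i, j, h1, by simp [h.val_one, one_mem]⟩
  act_fix_one := by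
    intro δ _
    simp [h.conjBy_one]
  dom_append_inv := by
    rintro η δ ⟨h0, i, j, h1, h2⟩
    refine ⟨by simp [h0], i, j, h1, fun x hx => ?_⟩
    simp only [PartialGroup.invWord, List.mem_append, List.mem_reverse, List.mem_map] at hx
    rcases hx with hx | ⟨y, hy, rfl⟩
    · exact h2 x hx
    · rw [h.val_inv]; exact inv_mem (h2 y hy)
  act_append_inv := by
    rintro η δ ⟨h0, i, j, h1, h2⟩
    rw [List.map_append, PartialGroup.invWord, PartialGroup.invWord, List.map_reverse,
      List.map_map, List.map_map]
    congr 2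
    exact List.map_congr_left fun x hx => h.conjBy_inv hγ h1 (h2 x hx)
  dom_inv_append := by
    rintro η δ ⟨h0, i, j, h1, h2⟩
    refine ⟨by simp [h0], i, j, h1, fun x hx => ?_⟩
    simp only [PartialGroup.invWord, List.mem_append, List.mem_reverse, List.mem_map] at hx
    rcases hx with ⟨y, hy, rfl⟩ | hx
    · rw [h.val_inv]; exact inv_mem (h2 y hy)
    · exact h2 x hx
  act_inv_append := by
    rintro η δ ⟨h0, i, j, h1, h2⟩
    rw [List.map_append, PartialGroup.invWord, PartialGroup.invWord, List.map_reverse,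
      List.map_map, List.map_map]
    congr 2
    exact List.map_congr_left fun x hx => h.conjBy_inv hγ h1 (h2 x hx)

/-- The choices of a route and of a representing word are harmless: the sum of `δ` is `j - i` for
every route, and the representing word is forced by `val`. -/
theorem conjAction_isConjugationAction (h : IsAmalgam jp jm val)
    (hγ : ConjugatesGroups Gp Gm γ) : IsConjugationAction jp jm γ (h.conjAction hγ) where
  dom_iff η δ _ := by
    change ConjDom Gp Gm val η δ ↔ _
    constructor
    · rintro ⟨h0, i, j, h1, h2⟩
      exact ⟨i, j, η.map val, by simpa using h0, h1,
        h.represents_iff.2 ⟨IsRoute.left_mem h1, h2, rfl⟩⟩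
    · rintro ⟨i, j, a, h0, h1, h2⟩
      obtain ⟨-, h3, rfl⟩ := h.represents_iff.1 h2
      exact ⟨by simpa using h0, i, j, h1, h3⟩
  act_eq η δ i j a _ _ h1 h2 := by
    obtain ⟨-, h3, rfl⟩ := h.represents_iff.1 h2
    have h1 : Route i δ j := h1
    refine h.represents_iff.2 ⟨IsRoute.right_mem h1, fun y hy => ?_, ?_⟩
    · obtain ⟨x, hx, rfl⟩ := List.mem_map.1 hy
      exact h.conjBy_mem hγ h1 (h3 x hx)
    · change _ = (η.map _).map val
      rw [List.map_map, List.map_map]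
      refine List.map_congr_left fun x hx => ?_
      rw [Function.comp_apply, Function.comp_apply, h.val_conjBy hγ h1 (h3 x hx), h1.eq_add]
      congr <;> ring

end IsAmalgam

end

/-! ### Words and products of the semidirect product -/

section

variable {G₀ : Type} [Group G₀] {Gp Gm : Subgroup G₀}
  {K : PartialGroup.{0}} {jp : PartialGroup.ofGroup Gp ⟶ K}
  {jm : PartialGroup.ofGroup Gm ⟶ K} {val : K → G₀} {γ : G₀}

/-- The word `α = (δ₁ ⋉ η₁, …, δₙ ⋉ ηₙ)` leads from `i = ι₀` to `j = ιₙ` inside `{0, 1}`, where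
`ιₖ = ιₖ₋₁ + δₖ`, and `ηₖ` lies in `G(ιₖ)`. -/
def SemidirectRoute (Gp Gm : Subgroup G₀) (val : K → G₀) : ℤ → List (V01 × K) → ℤ → Prop
  | i, [], j => i ∈ ({0, 1} : Set ℤ) ∧ i = j
  | i, a :: α, j => i ∈ ({0, 1} : Set ℤ) ∧ val a.2 ∈ groupAt Gp Gm (i + vec a.1) ∧
      SemidirectRoute Gp Gm val (i + vec a.1) α j

/-- The element `γ^δ η` of `G₀` given by `δ ⋉ η`. -/
noncomputable def semidirectVal (val : K → G₀) (γ : G₀) (a : V01 × K) : G₀ :=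
  γ ^ vec a.1 * val a.2

theorem SemidirectRoute.left_mem {i j : ℤ} {α : List (V01 × K)}
    (h : SemidirectRoute Gp Gm val i α j) : i ∈ ({0, 1} : Set ℤ) := by
  cases α <;> exact h.1

namespace IsAmalgam

/-- A semidirect route requires each ηₖ to lie in the group at its own position ιₖ, whereas A(α)
sees it only after transport to the end `j`. The two conditions are equivalent because conjugation
along the remaining path can be undone. -/
theorem semidirectRoute_iff (h : IsAmalgam jp jm val) (hγ : ConjugatesGroups Gp Gm γ) {i j : ℤ}
    {α : List (V01 × K)} : SemidirectRoute Gp Gm val i α j ↔ Route i (α.map Prod.fst) j ∧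
      (h.conjAction hγ).Composable α ∧
      ∀ x ∈ (h.conjAction hγ).wordA α, val x ∈ groupAt Gp Gm j := by
  induction α generalizing i with
  | nil =>
    constructor
    · intro h
      exact ⟨h, trivial, fun x hx => by cases hx⟩
    · intro h
      exact h.1
  | cons a α ih =>
    constructor
    · rintro ⟨h1, h2, h3⟩
      obtain ⟨i1, i2, i3⟩ := ih.1 h3
      refine ⟨⟨h1, i1⟩, ⟨⟨by simp, _, _, i1, by simpa using h2⟩, i2⟩, fun x hx => ?_⟩
      rcases List.mem_cons.1 hx with rfl | hx
      · exact h.conjBy_mem hγ i1 h2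
      · exact i3 x hx
    · rintro ⟨⟨h1, h2⟩, ⟨⟨-, k, l, h3, h4⟩, h5⟩, h6⟩
      refine ⟨h1, ?_, ih.2 ⟨h2, h5, fun x hx => h6 x (List.mem_cons_of_mem _ hx)⟩⟩
      have h7 : val (conjBy val γ ((α.map Prod.fst).map vec).sum a.2) ∈ groupAt Gp Gm j :=
        h6 _ List.mem_cons_self
      have h2 : Route (i + vec a.1) (α.map Prod.fst) j := h2
      -- The route from `k` to `l` supplied by composability need not start at `i + vec a.1`.
      -- Membership in the correct group comes from the letter of A(α) in G(j), conjugated back.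
      have h8 := hγ j (IsRoute.right_mem h2) _ (IsRoute.left_mem h2) _ h7
      rw [h.val_conjBy hγ h3 (h4 _ List.mem_cons_self), h2.eq_add] at h8
      generalize ((α.map Prod.fst).map vec).sum = s at h8
      have e : i + vec a.1 + s - (i + vec a.1) = s := by ring
      have e' : i + vec a.1 - (i + vec a.1 + s) = -s := by ring
      rw [e, e'] at h8
      have e3 : γ ^ s * (γ ^ (-s) * val a.2 * γ ^ s) * γ ^ (-s) = val a.2 := by group
      rwa [e3] at h8

/-- The action condition on A(α) involves the inverse word, whose route starts in the group
containing A(α). Reversing it gives a route of the original word that ends there. -/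
theorem mem_semidirectDom_iff (h : IsAmalgam jp jm val) (hγ : ConjugatesGroups Gp Gm γ)
    {α : List (V01 × K)} : α ∈ (h.conjAction hγ).semidirectDom ↔
      α ≠ [] ∧ ∃ i j, SemidirectRoute Gp Gm val i α j := by
  constructor
  · rintro ⟨h0, h1, -, j, i, h2, h3⟩
    have := h2.invWord
    rw [PartialGroup.invWord_invWord] at this
    exact ⟨h0, i, j, (h.semidirectRoute_iff hγ).2 ⟨this, h1, h3⟩⟩
  · rintro ⟨h0, i, j, h1⟩
    obtain ⟨h1, h2, h3⟩ := (h.semidirectRoute_iff hγ).1 h1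
    exact ⟨h0, h2, (h.conjAction hγ).wordA_ne_nil h0, j, i, h1.invWord, h3⟩

/-- Moving a power of γ to the left past η conjugates η. Collecting all powers at the front
therefore replaces ηₖ by ◁(ηₖ | δₖ₊₁, …, δₙ). -/
theorem prod_wordA (h : IsAmalgam jp jm val) (hγ : ConjugatesGroups Gp Gm γ) {i j : ℤ}
    {α : List (V01 × K)} (hα : SemidirectRoute Gp Gm val i α j) :
    γ ^ ((α.map Prod.fst).map vec).sum * (((h.conjAction hγ).wordA α).map val).prod =
      (α.map (semidirectVal val γ)).prod := by
  induction α generalizing i with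
  | nil => simp [PartialGroupAction.wordA]
  | cons a α ih =>
    obtain ⟨-, h2, h3⟩ := hα
    have h1 := ((h.semidirectRoute_iff hγ).1 h3).1
    have e : val ((h.conjAction hγ).actOne a.2 (α.map Prod.fst)) = _ := h.val_conjBy hγ h1 h2
    rw [PartialGroupAction.wordA, List.map_cons, List.map_cons, List.map_cons, List.map_cons,
      List.prod_cons, List.prod_cons, List.sum_cons, ← ih h3, e, semidirectVal]
    group

theorem semidirectVal_nabla (h : IsAmalgam jp jm val) (hγ : ConjugatesGroups Gp Gm γ)
    {α : List (V01 × K)} (hα : α ∈ (h.conjAction hγ).semidirectDom) :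
    semidirectVal val γ ((h.conjAction hγ).semidirectNabla α) =
      (α.map (semidirectVal val γ)).prod := by
  obtain ⟨h0, i, j, hr⟩ := (h.mem_semidirectDom_iff hγ).1 hα
  have h1 := ((h.semidirectRoute_iff hγ).1 hr).1
  rw [← h.prod_wordA hγ hr, semidirectVal, PartialGroupAction.semidirectNabla,
    V01.vec_nabla (h1.mem_dom (by simpa using h0)),
    h.val_nabla ((h.conjAction hγ).mem_of_dom hα.2.2)]

end IsAmalgam

end

/-! ### Parades in a pair of congruent sets that cannot be exchanged -/

section TwoPoints

variable {G₀ : Type} [Group G₀] {X₀ : Type} [MulAction G₀ᵐᵒᵖ X₀] {Fp Fm : Set X₀} {γ : G₀}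

/-- The sets `F(1) = F₊` and `F(0) = F₋`. -/
def setAt (Fp Fm : Set X₀) (i : ℤ) : Set X₀ := if i = 1 then Fp else Fm

theorem setAt_mem (i : ℤ) : setAt Fp Fm i ∈ ({Fp, Fm} : Set (Set X₀)) := by
  unfold setAt; split_ifs <;> simp

theorem exists_setAt {x : Set X₀} (hx : x ∈ ({Fp, Fm} : Set (Set X₀))) :
    ∃ i ∈ ({0, 1} : Set ℤ), setAt Fp Fm i = x := by
  rcases hx with rfl | rfl
  · exact ⟨1, by simp, rfl⟩
  · exact ⟨0, by simp, rfl⟩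

theorem mem_groupAt_iff {i : ℤ} {g : G₀} :
    g ∈ groupAt (symmetryGroup G₀ Fp) (symmetryGroup G₀ Fm) i ↔
      setAt Fp Fm i <• g = setAt Fp Fm i := by
  unfold groupAt setAt; split_ifs <;> rfl

theorem setAt_smul_zpow (hγ : Fm <• γ = Fp) {i j : ℤ} (hi : i ∈ ({0, 1} : Set ℤ))
    (hj : j ∈ ({0, 1} : Set ℤ)) : setAt Fp Fm i <• γ ^ (j - i) = setAt Fp Fm j := by
  rcases hi with rfl | rfl <;> rcases hj with rfl | rfl
  · simp
  · simpa [setAt] using hγ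
  · simp [setAt, ← hγ]
  · simp

/-- Reading from the left, γ^(i-j) carries F(j) to F(i), `g` fixes F(i), and γ^(j-i) carries F(i)
back to F(j). -/
theorem conjugatesGroups_symmetryGroup (hγ : Fm <• γ = Fp) :
    ConjugatesGroups (symmetryGroup G₀ Fp) (symmetryGroup G₀ Fm) γ := by
  intro i hi j hj g hg
  rw [mem_groupAt_iff] at hg ⊢
  rw [← op_smul_op_smul, ← op_smul_op_smul, setAt_smul_zpow hγ hj hi, hg, setAt_smul_zpow hγ hi hj]

/-- This is where the impossibility of an exchange does its work. If the starting sets agree, so do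
the final ones, as F₊ ≠ F₋. If they differ, the final ones differ too, so `g` either fixes both
sets, with both displacements 0, or exchanges them. -/
theorem displacement_unique (hne : Fp ≠ Fm)
    (hswap : ¬ ∃ a : G₀, Fp <• a = Fm ∧ Fm <• a = Fp) {g : G₀} {i j k l : ℤ}
    (hi : i ∈ ({0, 1} : Set ℤ)) (hj : j ∈ ({0, 1} : Set ℤ)) (hk : k ∈ ({0, 1} : Set ℤ))
    (hl : l ∈ ({0, 1} : Set ℤ)) (h1 : setAt Fp Fm i <• g = setAt Fp Fm j)
    (h2 : setAt Fp Fm k <• g = setAt Fp Fm l) : j - i = l - k := by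
  have h0 : setAt Fp Fm 0 = Fm := rfl
  have h1' : setAt Fp Fm 1 = Fp := rfl
  have hinj : ¬ Fp <• g = Fm <• g := fun e => hne (smul_left_cancel _ e)
  rcases hi with rfl | rfl <;> rcases hj with rfl | rfl <;> rcases hk with rfl | rfl <;>
    rcases hl with rfl | rfl <;> rw [h0] at * <;> simp_all

variable {K : PartialGroup.{0}} {jp : PartialGroup.ofGroup (symmetryGroup G₀ Fp) ⟶ K}
  {jm : PartialGroup.ofGroup (symmetryGroup G₀ Fm) ⟶ K} {val : K → G₀}

/-- The power of γ alone already makes the step, so only the action of η on the target set matters.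
This is the dictionary between the group condition on a letter and one step of a parade. -/
theorem setAt_smul_semidirectVal (hγ : Fm <• γ = Fp) {i : ℤ} {a : V01 × K}
    (hi : i ∈ ({0, 1} : Set ℤ)) (hj : i + vec a.1 ∈ ({0, 1} : Set ℤ)) :
    setAt Fp Fm i <• semidirectVal val γ a = setAt Fp Fm (i + vec a.1) ↔
      val a.2 ∈ groupAt (symmetryGroup G₀ Fp) (symmetryGroup G₀ Fm) (i + vec a.1) := by
  have e := setAt_smul_zpow hγ hi hj
  rw [add_sub_cancel_left] at e
  rw [mem_groupAt_iff, semidirectVal, ← op_smul_op_smul, e]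

theorem SemidirectRoute.isRoute (hγ : Fm <• γ = Fp) {i j : ℤ} {α : List (V01 × K)}
    (h : SemidirectRoute (symmetryGroup G₀ Fp) (symmetryGroup G₀ Fm) val i α j) :
    IsRoute (fun (x : Set X₀) (g : G₀) => x <• g) {Fp, Fm} (setAt Fp Fm i)
      (α.map (semidirectVal val γ)) (setAt Fp Fm j) := by
  induction α generalizing i with
  | nil => exact ⟨setAt_mem i, congrArg _ h.2⟩
  | cons a α ih =>
    refine ⟨setAt_mem i, ?_⟩
    dsimp only
    rw [(setAt_smul_semidirectVal hγ h.1 h.2.2.left_mem).2 h.2.1]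
    exact ih h.2.2

/-- Each letter is admissible by itself, but a priori for a step `k → l` unrelated to the set at
which the parade uses it. By `displacement_unique` both steps have the same displacement, so the
parade visits the indices prescribed by the δₖ, and each ηₖ fixes the set reached there. -/
theorem SemidirectRoute.of_isRoute (hne : Fp ≠ Fm)
    (hswap : ¬ ∃ a : G₀, Fp <• a = Fm ∧ Fm <• a = Fp) (hγ : Fm <• γ = Fp) {i : ℤ} {y : Set X₀}
    {α : List (V01 × K)} (hi : i ∈ ({0, 1} : Set ℤ))
    (hα : ∀ a ∈ α, ∃ k l,
      SemidirectRoute (symmetryGroup G₀ Fp) (symmetryGroup G₀ Fm) val k [a] l)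
    (h : IsRoute (fun (x : Set X₀) (g : G₀) => x <• g) {Fp, Fm} (setAt Fp Fm i)
      (α.map (semidirectVal val γ)) y) :
    ∃ j, SemidirectRoute (symmetryGroup G₀ Fp) (symmetryGroup G₀ Fm) val i α j := by
  induction α generalizing i with
  | nil => exact ⟨i, hi, rfl⟩
  | cons a α ih =>
    obtain ⟨k, l, hk, hv, hl, -⟩ := hα a List.mem_cons_self
    obtain ⟨-, h⟩ := h
    obtain ⟨j, hj, e⟩ := exists_setAt h.left_mem
    have e' := (setAt_smul_semidirectVal (val := val) hγ hk hl).2 hv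
    have hd := displacement_unique hne hswap hi hj hk hl e.symm e'
    obtain rfl : j = i + vec a.1 := by omega
    obtain ⟨m, hm⟩ := ih hj (fun b hb => hα b (List.mem_cons_of_mem _ hb)) (by rw [e]; exact h)
    exact ⟨m, hi, (setAt_smul_semidirectVal hγ hi hj).1 e.symm, hm⟩

/-- The isomorphism is built in the direction δ ⋉ η ↦ γ^δ η, where no choice is needed, and then
inverted. -/
theorem IsAmalgam.nonempty_iso (h : IsAmalgam jp jm val) (hne : Fp ≠ Fm)
    (hswap : ¬ ∃ a : G₀, Fp <• a = Fm ∧ Fm <• a = Fp) (hγ : Fm <• γ = Fp)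
    (hX : ({Fp, Fm} : Set (Set X₀)).Nonempty) :
    Nonempty ((paradeSystem G₀ {Fp, Fm} hX).toPartialGroup ≅
      (h.conjAction (conjugatesGroups_symmetryGroup hγ)).semidirectSystem.toPartialGroup) := by
  set S := h.conjAction (conjugatesGroups_symmetryGroup hγ)
  have hdom : ∀ {α}, α ∈ S.semidirectDom ↔ _ := h.mem_semidirectDom_iff _
  have hmap : ∀ w : List S.semidirectSystem.toPartialGroup,
      w.map (fun x => semidirectVal val γ (WordSystem.val x)) =
      (w.map WordSystem.val).map (semidirectVal val γ) := fun w =>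
    (List.map_map_of_comp_eq (fun _ => rfl) w).symm
  let f : S.semidirectSystem.toPartialGroup ⟶ (paradeSystem G₀ {Fp, Fm} hX).toPartialGroup :=
    WordSystem.lift (D := paradeSystem G₀ {Fp, Fm} hX)
      (fun x : S.semidirectSystem.toPartialGroup => semidirectVal val γ (WordSystem.val x))
      (fun {w} hw => by
        obtain ⟨h0, i, j, hr⟩ := hdom.1 (WordSystem.map_val_mem.1 hw)
        rw [hmap]
        exact ⟨by simpa only [ne_eq, List.map_eq_nil_iff] using h0, _, _, hr.isRoute hγ⟩)
      (fun {w} hw => by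
        rw [hmap]
        exact ((congrArg _ (WordSystem.val_nabla hw)).trans
          (h.semidirectVal_nabla _ (WordSystem.map_val_mem.1 hw))).symm)
  have hf : ∀ x, WordSystem.val (f.fn x) = semidirectVal val γ (WordSystem.val x) := fun _ => rfl
  have hel : ∀ x : S.semidirectSystem.toPartialGroup, ∃ i j,
      SemidirectRoute (symmetryGroup G₀ Fp) (symmetryGroup G₀ Fm) val i [WordSystem.val x] j := fun x =>
    (hdom.1 (Subtype.property (p := fun t => [t] ∈ S.semidirectSystem.dom) x)).2
  refine ⟨(PartialGroup.isoOfBijective f ⟨fun x y hxy => ?_, fun y => ?_⟩ fun w hw => ?_).symm⟩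
  -- Injectivity: one element of `G₀` has only one displacement, so the δ-components agree and the
  -- power of γ cancels.
  · have e : semidirectVal val γ (WordSystem.val x) = semidirectVal val γ (WordSystem.val y) :=
      congrArg WordSystem.val hxy
    obtain ⟨i, j, hi, hx, hj, -⟩ := hel x
    obtain ⟨k, l, hk, hy, hl, -⟩ := hel y
    have hx' := (setAt_smul_semidirectVal hγ hi hj).2 hx
    have hy' := (setAt_smul_semidirectVal hγ hk hl).2 hy
    rw [← e] at hy'
    have hd := displacement_unique hne hswap hi hj hk hl hx' hy'
    have hv : vec (WordSystem.val x).1 = vec (WordSystem.val y).1 := by omega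
    refine WordSystem.val_injective (Prod.ext (V01.vec_injective hv) (h.injective ?_))
    rw [semidirectVal, semidirectVal, hv] at e
    exact mul_left_cancel e
  -- Surjectivity: if `y` carries F(i) to F(j), take δ = j - i and η = γ^(i-j) y, which fixes F(j).
  · obtain ⟨-, x, z, hx, hz, -⟩ :=
      Subtype.property (p := fun t => [t] ∈ (paradeSystem G₀ {Fp, Fm} hX).dom) y
    obtain ⟨i, hi, rfl⟩ := exists_setAt hx
    obtain ⟨j, hj, e⟩ := exists_setAt hz
    obtain ⟨δ, hδ⟩ := V01.exists_vec hi hj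
    have hg : γ ^ (i - j) * WordSystem.val y ∈
        groupAt (symmetryGroup G₀ Fp) (symmetryGroup G₀ Fm) j := by
      rw [mem_groupAt_iff, ← op_smul_op_smul, setAt_smul_zpow hγ hj hi]
      exact e.symm
    obtain ⟨η, hη⟩ := h.exists_val hg
    have hij : i + vec δ = j := by omega
    have hm : [(δ, η)] ∈ S.semidirectDom :=
      hdom.2 ⟨by simp, i, j, hi, by rw [hij, hη]; exact hg, by rw [hij]; exact hj, hij⟩
    refine ⟨(⟨(δ, η), hm⟩ : {t // [t] ∈ S.semidirectSystem.dom}), WordSystem.val_injective ?_⟩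
    refine (hf _).trans ?_
    change γ ^ vec δ * val η = _
    rw [hη, hδ, ← mul_assoc, ← zpow_add]
    simp
  -- Words are reflected: the letters are elements of the semidirect product whose images form a
  -- parade.
  · obtain ⟨h0, x, z, hr⟩ := WordSystem.map_val_mem.1 hw
    rw [List.map_map_of_comp_eq hf, hmap] at hr
    obtain ⟨i, hi, rfl⟩ := exists_setAt hr.left_mem
    obtain ⟨j, hj⟩ := SemidirectRoute.of_isRoute hne hswap hγ hi (fun a ha => by
      obtain ⟨x, -, rfl⟩ := List.mem_map.1 ha
      exact hel x) hr
    refine WordSystem.map_val_mem.2 (hdom.2 ⟨?_, i, j, hj⟩)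
    simpa only [ne_eq, List.map_eq_nil_iff] using h0

/-- Two sets that are exchanged by no element of `G₀`, but are congruent under `G₀`: the parades in
`{F₊, F₋}` form a semidirect product of `𝒱({0, 1})` and a pushout of symmetry groups. -/
theorem parades_pair_iso (hne : Fp ≠ Fm)
    (hswap : ¬ ∃ a : G₀, Fp <• a = Fm ∧ Fm <• a = Fp) {X : Set (Set X₀)} (hX : X.Nonempty)
    (hXe : X = {Fp, Fm}) (hK : IsPushout (interToLeft _ _) (interToRight _ _) jp jm)
    (hγ : Fm <• γ = Fp) :
    ∃ S : PartialGroupAction V01 K, IsConjugationAction jp jm γ S ∧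
      Nonempty (parades G₀ X hX ≅ S.semidirect) := by
  -- Keeping the set of points as a variable `X` lets its description as a pair be substituted, so
  -- that no transport between parade partial groups is needed.
  subst hXe
  obtain ⟨val, h⟩ := exists_isAmalgam hK
  exact ⟨_, h.conjAction_isConjugationAction (conjugatesGroups_symmetryGroup hγ),
    h.nonempty_iso hne hswap hγ hX⟩

end TwoPoints

theorem theorem12p1 (d : ℕ) (F Fp Fm : Set (Space d)) (hF : F.Nonempty)
    (hcc : components F = {Fp, Fm}) (hne : Fp ≠ Fm)
    (hcongr : ∃ a : EuclideanGroup d, Fp <• a = Fm)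
    (hswap : ¬ ∃ a : EuclideanGroup d, Fp <• a = Fm ∧ Fm <• a = Fp) :
    (Limits.HasPushout
        (interToLeft (symmetryGroup (EuclideanGroup d) Fp) (symmetryGroup (EuclideanGroup d) Fm))
        (interToRight (symmetryGroup (EuclideanGroup d) Fp) (symmetryGroup (EuclideanGroup d) Fm)) ∧
      ∀ (K : PartialGroup.{0})
        (jp : PartialGroup.ofGroup (symmetryGroup (EuclideanGroup d) Fp) ⟶ K)
        (jm : PartialGroup.ofGroup (symmetryGroup (EuclideanGroup d) Fm) ⟶ K),
        IsPushout (interToLeft _ _) (interToRight _ _) jp jm →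
        ∀ γ : EuclideanGroup d, Fm <• γ = Fp →
          ∃ S : PartialGroupAction V01 K, IsConjugationAction jp jm γ S ∧
            Nonempty (figureSymmetry (EuclideanGroup d) F hF ≅ S.semidirect)) ∧
    ((∃ a : EuclideanGroup.motions d, Fp <• a = Fm) →
      Limits.HasPushout
        (interToLeft (symmetryGroup (EuclideanGroup.motions d) Fp)
          (symmetryGroup (EuclideanGroup.motions d) Fm))
        (interToRight (symmetryGroup (EuclideanGroup.motions d) Fp)
          (symmetryGroup (EuclideanGroup.motions d) Fm)) ∧
      ∀ (K : PartialGroup.{0})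
        (jp : PartialGroup.ofGroup (symmetryGroup (EuclideanGroup.motions d) Fp) ⟶ K)
        (jm : PartialGroup.ofGroup (symmetryGroup (EuclideanGroup.motions d) Fm) ⟶ K),
        IsPushout (interToLeft _ _) (interToRight _ _) jp jm →
        ∀ γ : EuclideanGroup.motions d, Fm <• γ = Fp →
          ∃ S : PartialGroupAction V01 K, IsConjugationAction jp jm γ S ∧
            Nonempty (figureSymmetry (EuclideanGroup.motions d) F hF ≅ S.semidirect)) := by
  -- Both assertions are instances of `parades_pair_iso`. The hypothesis on exchanges passes to
  -- M(d), since a motion acts through its underlying isometry.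
  have hswap' : ¬ ∃ a : EuclideanGroup.motions d, Fp <• a = Fm ∧ Fm <• a = Fp :=
    fun ⟨a, h1, h2⟩ => hswap ⟨a, h1, h2⟩
  exact ⟨⟨(isPushout_union _ _).hasPushout, fun K jp jm hK γ hγ =>
      parades_pair_iso hne hswap (components_nonempty hF) hcc hK hγ⟩,
    fun _ => ⟨(isPushout_union _ _).hasPushout, fun K jp jm hK γ hγ =>
      parades_pair_iso hne hswap' (components_nonempty hF) hcc hK hγ⟩⟩
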